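/- Let $\lambda\ge 0$, $\sigma_1>0$, $\sigma_2\ge 0$, $\kappa,\rho,\delta>0$ and $\gamma_{\max}>-\lambda\sigma_1^2+\sqrt{\lambda^2\sigma_1^4+\sigma_1^2\sigma_2^2}$. Put $$f(\gamma,h)=-(\sigma_1^{-2}+h)\gamma^2-2\lambda\gamma+\sigma_2^2,\qquad a_1=\tfrac14\bigl(-\delta\rho+\sqrt{\delta^2\rho^2+4\kappa\rho}\bigr),\qquad a_3=\frac{2a_1\rho}{\delta\rho+\lambda\rho+2a_1},$$ $$a_2=\frac{a_3(2\rho-a_3)}{2\rho(2\lambda+\delta)},\qquad \bar a=a_3-a_2(2\lambda+\delta),\qquad M_0=\gamma_{\max}^2\,\frac{\bar a}{\delta}.$$ A cost function is a strictly convex and strictly increasing $c:[0,\infty)\to[0,\infty)$ that is continuously differentiable on $[0,\infty)$ and twice continuously differentiable on $(0,\infty)$. Suppose that $M_0\le c'(h)$ for some $h\ge 0$, and let $h_{\max}=\inf\{h\ge 0: c'(h)\ge M_0\}$; thus $h_{\max}=(c')^{-1}(M_0)$ if $M_0\ge c'(0)$, and $h_{\max}=0$ otherwise. Admissible information acquisition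 rates are the Borel functions $h:[0,\infty)\to[0,h_{\max}]$. The corresponding conditional variance started at $\gamma_0\in[0,\gamma_{\max}]$ is the absolutely continuous solution of $\dot\gamma_t=f(\gamma_t,h_t)$, $\gamma_0$ given, the cost of $h$ is $\int_0^\infty e^{-\delta t}(\bar a\gamma_t+c(h_t))\,dt$, and $v(\gamma_0)$ is the infimum of the cost over all admissible $h$. Let $$H^*(\gamma)=\hat h\bigl(\gamma^2v'(\gamma)\bigr),\quad \gamma\in[0,\gamma_{\max}],\qquad \hat h(x)=\operatorname*{arg\,max}_{h\in[0,h_{\max}]}\{hx-c(h)\},$$ where $v'$ is one-sided at $0$ and $\gamma_{\max}$. Let $\check v(y)=v(1/y)$ for $y\in[1/\gamma_{\max},\infty]$ (with $1/\infty=0$), let $\check v'$ be its derivative, one-sided at $1/\gamma_{\max}$, and $\check v'(\infty)=\lim_{y\to\infty}\check v'(y)$. Define $\gamma_{\mathcal D}=1/(\check v')^{-1}(-c'(0))$ if $-c'(0)\in\check v'([1/\gamma_{\max},\infty])$, and $\gamma_{\mathcal D}=\gamma_{\max}$ otherwise. **(i)** For every such $c$: $v$ is differentiable on $[0,\gamma_{\max}]$,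 the limit $\check v'(\infty)$ exists and $\check v'$ is injective on $[1/\gamma_{\max},\infty]$ (so that all of the above is well defined); $\gamma_{\mathcal D}\in[0,\gamma_{\max}]$; $H^*=0$ on $[0,\gamma_{\mathcal D}]$; and $H^*$ is strictly increasing on $[\gamma_{\mathcal D},\gamma_{\max}]$. Moreover, $H^*$ is an optimal feedback: for every $\gamma_0\in[0,\gamma_{\max}]$ there are a continuous admissible $h$ and a corresponding $[0,\gamma_{\max}]$-valued conditional variance $\gamma$ started at $\gamma_0$ such that $h_t=H^*(\gamma_t)$ for all $t\ge0$ and the infimum $v(\gamma_0)$ is attained by $h$. So it is optimal to acquire no information while the variance is at most $\gamma_{\mathcal D}$, and to acquire it at a positive rate that increases with the variance above $\gamma_{\mathcal D}$. **(ii)** For all $\zeta,\epsilon>0$, the power cost $c(x)=\zeta x^{1+\epsilon}$ is a cost function for which $M_0\le c'(h)$ for some $h\ge0$, and its threshold is $\gamma_{\mathcal D}=0$. -/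

import Mathlib

open Set Filter Topology MeasureTheory
open scoped ENNReal

noncomputable section

namespace InfoAcquisition

/-- The parameters of the problem with their standing assumptions: mean reversion speed `lam`,
volatilities `σ₁`, `σ₂`, cost coefficients `κ`, `ρ`, discount rate `δ`, and an upper bound `γmax`
for the conditional variance that exceeds the uncontrolled equilibrium variance. -/
structure Model where
  lam : ℝ
  σ₁ : ℝ
  σ₂ : ℝ
  κ : ℝ
  ρ : ℝ
  δ : ℝ
  γmax : ℝ
  lam_nonneg : 0 ≤ lam
  σ₁_pos : 0 < σ₁
  σ₂_nonneg : 0 ≤ σ₂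
  κ_pos : 0 < κ
  ρ_pos : 0 < ρ
  δ_pos : 0 < δ
  γmax_gt : -lam * σ₁ ^ 2 + √(lam ^ 2 * σ₁ ^ 4 + σ₁ ^ 2 * σ₂ ^ 2) < γmax

/-- Standing assumption on the information cost `c : [0,∞) → [0,∞)` (values of `c` at negative
arguments are irrelevant): strictly convex, strictly increasing, and twice continuously
differentiable. Second derivatives are required on `(0,∞)` only, so that the power costs
`ζ x ^ (1 + ε)` are included for every `ε > 0`. -/
structure IsCost (c : ℝ → ℝ) : Prop where
  nonneg : ∀ x, 0 ≤ x → 0 ≤ c x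
  strictConvex : StrictConvexOn ℝ (Ici 0) c
  strictMono : StrictMonoOn c (Ici 0)
  contDiff_one : ContDiffOn ℝ 1 c (Ici 0)
  contDiff_two : ContDiffOn ℝ 2 c (Ioi 0)

/-- The marginal cost `c'` on `[0,∞)`, one-sided at `0`. -/
def marginalCost (c : ℝ → ℝ) (x : ℝ) : ℝ := derivWithin c (Ici 0) x

/-- The power cost `ζ x ^ (1 + ε)`. -/
def powerCost (ζ ε : ℝ) (x : ℝ) : ℝ := ζ * x ^ (1 + ε)

namespace Model

variable (m : Model)

/-- The Riccati right-hand side `f(γ,h) = -(σ₁⁻² + h) γ² - 2 λ γ + σ₂²`. -/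
def f (γ h : ℝ) : ℝ := -((1 / m.σ₁) ^ 2 + h) * γ ^ 2 - 2 * m.lam * γ + m.σ₂ ^ 2

def a₁ : ℝ := -(m.δ * m.ρ) / 4 + √(m.δ ^ 2 * m.ρ ^ 2 + 4 * m.κ * m.ρ) / 4

def a₃ : ℝ := 2 * m.a₁ * m.ρ / (m.δ * m.ρ + m.lam * m.ρ + 2 * m.a₁)

def a₂ : ℝ := m.a₃ * (2 * m.ρ - m.a₃) / (2 * m.ρ * (2 * m.lam + m.δ))

def aBar : ℝ := m.a₃ - m.a₂ * (2 * m.lam + m.δ)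

def Lv : ℝ := m.aBar / m.δ

def M₀ : ℝ := m.γmax ^ 2 * m.Lv

/-- The largest rate `hmax = (c')⁻¹(M₀)`; this generalized inverse also covers `M₀ < c'(0)`,
where it is `0`. -/
def hMax (c : ℝ → ℝ) : ℝ := sInf {h | 0 ≤ h ∧ m.M₀ ≤ marginalCost c h}

/-- Admissible rates: Borel functions `[0,∞) → [0,hmax]` (values at negative times are
irrelevant). -/
def Admissible (c : ℝ → ℝ) (h : ℝ → ℝ) : Prop :=
  Measurable h ∧ ∀ t, 0 ≤ t → h t ∈ Icc 0 (m.hMax c)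

/-- `γ` is the conditional variance started at `γ₀` under the rate `h`: a Carathéodory solution
on `[0,∞)` of `γ' = f(γ, h)`, in integrated form. -/
def IsState (h : ℝ → ℝ) (γ₀ : ℝ) (γ : ℝ → ℝ) : Prop :=
  ContinuousOn γ (Ici 0) ∧ ∀ t, 0 ≤ t → γ t = γ₀ + ∫ s in (0 : ℝ)..t, m.f (γ s) (h s)

/-- The discounted cost of the rate `h` along the state `γ`. -/
def cost (c : ℝ → ℝ) (h γ : ℝ → ℝ) : ℝ :=
  ∫ t in Ioi (0 : ℝ), Real.exp (-m.δ * t) * (m.aBar * γ t + c (h t))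

/-- All costs that admissible rates produce from the initial variance `γ₀`. -/
def costs (c : ℝ → ℝ) (γ₀ : ℝ) : Set ℝ :=
  {J | ∃ h γ, m.Admissible c h ∧ m.IsState h γ₀ γ ∧ J = m.cost c h γ}

/-- The value function of the reduced problem. -/
def v (c : ℝ → ℝ) (γ₀ : ℝ) : ℝ := sInf (m.costs c γ₀)

/-- The derivative `v'` on `[0,γmax]`, one-sided at the end points. -/
def vDeriv (c : ℝ → ℝ) (γ : ℝ) : ℝ := derivWithin (m.v c) (Icc 0 m.γmax) γ

/-- `ĥ(x)` is a maximizer of `h x - c(h)` over `h ∈ [0,hmax]`; it is unique for cost functions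
(see `existsUnique_maximizer` below). -/
def hHat (c : ℝ → ℝ) (x : ℝ) : ℝ :=
  Classical.epsilon fun h : ℝ =>
    h ∈ Icc 0 (m.hMax c) ∧ IsMaxOn (fun h => h * x - c h) (Icc 0 (m.hMax c)) h

/-- The feedback map `H*(γ) = ĥ(γ² v'(γ))`. -/
def feedback (c : ℝ → ℝ) (γ : ℝ) : ℝ := m.hHat c (γ ^ 2 * m.vDeriv c γ)

/-- The derivative on `[1/γmax, ∞)`, one-sided at the left end point, of the value function
`y ↦ v(1/y)` in terms of the conditional precision. -/
def vCheckDeriv (c : ℝ → ℝ) (y : ℝ) : ℝ :=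
  derivWithin (fun z => m.v c (1 / z)) (Ici (1 / m.γmax)) y

/-- The same derivative on `[1/γmax, ∞]`, extended to infinite precision by its limit. -/
def vCheckDerivExt (c : ℝ → ℝ) (y : ℝ≥0∞) : ℝ :=
  if y = ∞ then limUnder atTop (m.vCheckDeriv c) else m.vCheckDeriv c y.toReal

open Classical in
/-- The threshold: `1/y` for the precision `y ∈ [1/γmax, ∞]` at which the derivative of the value
function is `-c'(0)`, where `1/∞ = 0`, and `γmax` if there is no such precision. -/
def γD (c : ℝ → ℝ) : ℝ :=
  if ex : ∃ y : ℝ≥0∞, ENNReal.ofReal (1 / m.γmax) ≤ y ∧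
      m.vCheckDerivExt c y = -marginalCost c 0 then
    (1 / ex.choose).toReal
  else m.γmax

theorem hMax_nonneg (c : ℝ → ℝ) : 0 ≤ m.hMax c := Real.sInf_nonneg fun _ hx => hx.1

theorem existsUnique_maximizer {c : ℝ → ℝ} (hc : IsCost c) (x : ℝ) :
    ∃! h : ℝ, h ∈ Icc 0 (m.hMax c) ∧
      IsMaxOn (fun h => h * x - c h) (Icc 0 (m.hMax c)) h := by
  have hsub : Icc 0 (m.hMax c) ⊆ Ici (0 : ℝ) := fun y hy => hy.1
  have hcont : ContinuousOn (fun h => h * x - c h) (Icc 0 (m.hMax c)) :=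
    (continuousOn_id.mul continuousOn_const).sub (hc.contDiff_one.continuousOn.mono hsub)
  obtain ⟨h, hmem, hmax⟩ := isCompact_Icc.exists_isMaxOn
    (nonempty_Icc.mpr (m.hMax_nonneg c)) hcont
  refine ⟨h, ⟨hmem, hmax⟩, ?_⟩
  rintro k ⟨kmem, kmax⟩
  have hlin : ConcaveOn ℝ (Icc 0 (m.hMax c)) (fun h : ℝ => h * x) :=
    ⟨convex_Icc _ _, fun a _ b _ s t _ _ _ => le_of_eq (by simp only [smul_eq_mul]; ring)⟩
  have hconc : StrictConcaveOn ℝ (Icc 0 (m.hMax c)) (fun h => h * x - c h) :=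
    hlin.sub_strictConvexOn (hc.strictConvex.subset hsub (convex_Icc _ _))
  exact hconc.eq_of_isMaxOn kmax hmax kmem hmem

/-- If `c'(h) = M₀` then `hMax` is `h`, that is, `(c')⁻¹(M₀)`. -/
theorem hMax_eq {c : ℝ → ℝ} (hc : StrictMonoOn (marginalCost c) (Ici 0)) {h : ℝ} (h0 : 0 ≤ h)
    (hh : marginalCost c h = m.M₀) : m.hMax c = h := by
  have : {x | 0 ≤ x ∧ m.M₀ ≤ marginalCost c x} = Ici h := by
    ext x
    constructor
    · rintro ⟨hx, hle⟩
      exact (hc.le_iff_le h0 hx).mp (hh.trans_le hle)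
    · intro hx
      exact ⟨h0.trans hx, hh.symm.trans_le ((hc.le_iff_le h0 (h0.trans hx)).mpr hx)⟩
  rw [hMax, this, csInf_Ici]

end Model

end InfoAcquisition

end

open InfoAcquisition

/-! Two curvature properties of `v` carry the proof. Under a fixed rate the drift `f` is decreasing
and concave in the variance, so paths keep their order, do not spread, and depend concavely on the
initial variance. Taking infima, `v` is nondecreasing, concave, and `Lv`-Lipschitz. The precision y
= 1/γ solves y' = σ₁⁻² + h + 2λy - σ₂²y², whose right-hand side is jointly concave in (y, h). Mixing
rates, and using that c and y ↦ 1/y are convex, shows that v(1/y) is convex in y (`vCheck_convex`).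
A concave function that is convex after a smooth change of variable has no kinks, so `v` is
differentiable, and `sens`, that is γ²v'(γ), which is minus the derivative of v(1/y) at y = 1/γ, is
continuous and nondecreasing.

The maximizer ĥ vanishes up to c'(0) and inverts c' on [c'(0), M₀], and v' ≤ `Lv` keeps `sens` below
M₀. Hence H* is continuous and nondecreasing, and γ ↦ f(γ, H*(γ)) is a continuous decreasing drift,
for which the closed loop is solvable without any Lipschitz condition. Optimality needs only the
supersolution half of the Hamilton–Jacobi–Bellman equation (`hjb_le`): along the closed loop,
discounted value plus accumulated cost never increases, so the cost is at most `v`.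

Attainment of the infimum then makes the convexity in the precision strict, because optimal paths
from different initial variances stay different for a while. So `sens` is strictly increasing, the
threshold is the point where it crosses c'(0), and H* increases strictly beyond it. For power costs
c'(0) = 0 is the limiting slope at infinite precision, whence the threshold 0. -/

namespace InfoAcquisition

/-! ### Primitives and comparison of differential inequalities -/

/-- `x` is on `[0,∞)` a continuous primitive of the locally integrable function `φ`. -/
structure IsPrimitive (x φ : ℝ → ℝ) : Prop where
  cont : ContinuousOn x (Ici 0)
  integrable : ∀ t, 0 ≤ t → IntervalIntegrable φ volume 0 t
  eq : ∀ t, 0 ≤ t → x t = x 0 + ∫ s in (0 : ℝ)..t, φ s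

namespace IsPrimitive

variable {x y φ ψ : ℝ → ℝ}

theorem sub_eq (h : IsPrimitive x φ) {s t : ℝ} (hs : 0 ≤ s) (ht : 0 ≤ t) :
    x t - x s = ∫ u in s..t, φ u := by
  rw [h.eq t ht, h.eq s hs, ← intervalIntegral.integral_interval_sub_left
    (h.integrable t ht) (h.integrable s hs)]
  ring

theorem integrable' (h : IsPrimitive x φ) {s t : ℝ} (hs : 0 ≤ s) (ht : 0 ≤ t) :
    IntervalIntegrable φ volume s t :=
  (h.integrable s hs).symm.trans (h.integrable t ht)

theorem add (hx : IsPrimitive x φ) (hy : IsPrimitive y ψ) :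
    IsPrimitive (fun t => x t + y t) (fun t => φ t + ψ t) where
  cont := hx.cont.add hy.cont
  integrable t ht := (hx.integrable t ht).add (hy.integrable t ht)
  eq t ht := by
    rw [intervalIntegral.integral_add (hx.integrable t ht) (hy.integrable t ht), hx.eq t ht,
      hy.eq t ht]
    ring

theorem const_mul (a : ℝ) (hx : IsPrimitive x φ) :
    IsPrimitive (fun t => a * x t) (fun t => a * φ t) where
  cont := continuousOn_const.mul hx.cont
  integrable t ht := (hx.integrable t ht).const_mul a
  eq t ht := by rw [intervalIntegral.integral_const_mul, hx.eq t ht]; ring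

theorem sub (hx : IsPrimitive x φ) (hy : IsPrimitive y ψ) :
    IsPrimitive (fun t => x t - y t) (fun t => φ t - ψ t) := by
  simpa [sub_eq_add_neg] using hx.add (hy.const_mul (-1))

theorem of_hasDerivAt (hx : ∀ t, HasDerivAt x (φ t) t) (hφ : Continuous φ) : IsPrimitive x φ where
  cont := fun t _ => (hx t).continuousAt.continuousWithinAt
  integrable t _ := hφ.intervalIntegrable 0 t
  eq t _ := by
    rw [intervalIntegral.integral_eq_sub_of_hasDerivAt (fun s _ => hx s)
      (hφ.intervalIntegrable 0 t)]
    ring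

theorem const (a : ℝ) : IsPrimitive (fun _ => a) (fun _ => 0) :=
  of_hasDerivAt (fun t => hasDerivAt_const t a) continuous_const

theorem abs_sub_le (h : IsPrimitive x φ) {K : ℝ} (hK : ∀ s, 0 ≤ s → |φ s| ≤ K) {s t : ℝ}
    (hs : 0 ≤ s) (ht : 0 ≤ t) : |x t - x s| ≤ K * |t - s| := by
  rw [h.sub_eq hs ht]
  refine intervalIntegral.norm_integral_le_of_norm_le_const (C := K) (f := φ) fun u hu => hK u ?_
  rcases le_total s t with h | h
  · rw [uIoc_of_le h] at hu; exact hs.trans hu.1.le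
  · rw [uIoc_of_ge h] at hu; exact ht.trans hu.1.le

/-- Comparison principle: a primitive that starts nonnegative and whose derivative is at least
`K` times its value wherever it is negative remains nonnegative. -/
theorem nonneg (h : IsPrimitive x φ) {K T : ℝ} (hK : 0 ≤ K) (h0 : 0 ≤ x 0)
    (hneg : ∀ s ∈ Icc 0 T, x s < 0 → K * x s ≤ φ s) : ∀ t ∈ Icc 0 T, 0 ≤ x t := by
  intro t₁ ht₁
  by_contra! hlt
  have hc : ContinuousOn x (Icc 0 t₁) := h.cont.mono fun s hs => hs.1
  have hS : IsCompact (Icc 0 t₁ ∩ x ⁻¹' Ici 0) :=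
    isCompact_Icc.of_isClosed_subset (hc.preimage_isClosed_of_isClosed isClosed_Icc isClosed_Ici)
      inter_subset_left
  -- Let t₀ be the last time before t₁ with x ≥ 0, and s a minimum point of x on a window after t₀
  -- so short that K times its length is at most 1/2. Then x s ≥ x t₀ + K (s - t₀) x s ≥ x s / 2,
  -- which contradicts x s < 0.
  obtain ⟨t₀, ⟨⟨h00, h01⟩, hx0⟩, hmax⟩ := hS.exists_isGreatest ⟨0, ⟨le_rfl, ht₁.1⟩, h0⟩
  have hx0 : 0 ≤ x t₀ := hx0
  have hlt' : ∀ s, t₀ < s → s ≤ t₁ → x s < 0 := by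
    intro s hs hs1
    by_contra! hn
    exact absurd (hmax ⟨⟨h00.trans hs.le, hs1⟩, hn⟩) (not_le.2 hs)
  have h01' : t₀ < t₁ := lt_of_le_of_ne h01 (by rintro rfl; linarith)
  obtain ⟨t₂, h02, h21, hKt⟩ : ∃ t₂, t₀ < t₂ ∧ t₂ ≤ t₁ ∧ K * (t₂ - t₀) ≤ 1 / 2 := by
    refine ⟨min t₁ (t₀ + 1 / (2 * (K + 1))), lt_min h01' (by simp; positivity), min_le_left _ _, ?_⟩
    have : min t₁ (t₀ + 1 / (2 * (K + 1))) - t₀ ≤ 1 / (2 * (K + 1)) := by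
      linarith [min_le_right t₁ (t₀ + 1 / (2 * (K + 1)))]
    calc _ ≤ K * (1 / (2 * (K + 1))) := by gcongr
      _ ≤ 1 / 2 := by rw [mul_one_div, div_le_div_iff₀] <;> linarith
  obtain ⟨s, hs, hmin⟩ := isCompact_Icc.exists_isMinOn (nonempty_Icc.2 h02.le)
    (h.cont.mono (fun u hu => h00.trans hu.1 : Icc t₀ t₂ ⊆ Ici 0))
  have hxs : x s < 0 := (hmin (right_mem_Icc.2 h02.le)).trans_lt (hlt' t₂ h02 h21)
  have hs0 : t₀ < s := lt_of_le_of_ne hs.1 (by rintro rfl; linarith)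
  have hint : ∫ _ in t₀..s, K * x s ≤ ∫ u in t₀..s, φ u := by
    refine intervalIntegral.integral_mono_on_of_le_Ioo hs.1 (by simp)
      (h.integrable' h00 (h00.trans hs.1)) fun u hu => ?_
    have hu1 : u ≤ t₁ := hu.2.le.trans (hs.2.trans h21)
    refine le_trans ?_ (hneg u ⟨h00.trans hu.1.le, hu1.trans ht₁.2⟩ (hlt' u hu.1 hu1))
    have : x s ≤ x u := hmin ⟨hu.1.le, hu.2.le.trans hs.2⟩
    gcongr
  rw [intervalIntegral.integral_const, ← h.sub_eq h00 (h00.trans hs.1), smul_eq_mul] at hint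
  have h3 : K * (s - t₀) ≤ 1 / 2 := le_trans (by gcongr; exact hs.2) hKt
  nlinarith

/-- The chain rule for the reciprocal of a positive primitive of a bounded function. -/
theorem reciprocal (h : IsPrimitive x φ) {K : ℝ} (hK : ∀ s, 0 ≤ s → |φ s| ≤ K)
    (hpos : ∀ s, 0 ≤ s → 0 < x s) :
    IsPrimitive (fun t => 1 / x t) (fun t => -(φ t / x t ^ 2)) := by
  have hcont : ContinuousOn (fun t => 1 / x t) (Ici 0) :=
    continuousOn_const.div h.cont fun t ht => (hpos t ht).ne'
  have hint : ∀ t, 0 ≤ t → IntervalIntegrable (fun t => -(φ t / x t ^ 2)) volume 0 t := by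
    intro t ht
    have hc : ContinuousOn (fun t => -(1 / x t ^ 2)) (uIcc 0 t) := by
      refine (continuousOn_const.div ((h.cont.mono ?_).pow 2) ?_).neg
      · intro s hs; rw [uIcc_of_le ht] at hs; exact hs.1
      · intro s hs; rw [uIcc_of_le ht] at hs; exact (pow_pos (hpos s hs.1) 2).ne'
    refine ((h.integrable t ht).mul_continuousOn hc).congr ?_
    intro s _
    dsimp only
    ring
  refine ⟨hcont, hint, fun t ht => ?_⟩
  have hu : uIcc 0 t = Icc 0 t := uIcc_of_le ht
  obtain ⟨s₀, hs₀, hmin⟩ := isCompact_Icc.exists_isMinOn (nonempty_Icc.2 ht)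
    (h.cont.mono (fun u hu => hu.1 : Icc 0 t ⊆ Ici 0))
  have hK0 : 0 ≤ K := (abs_nonneg _).trans (hK 0 le_rfl)
  have hm := hpos s₀ hs₀.1
  -- On a compact interval x is Lipschitz and bounded away from 0, so 1/x is absolutely continuous
  -- and is the integral of its almost everywhere derivative.
  have hlip : LipschitzOnWith (Real.toNNReal (K / x s₀ ^ 2)) (fun t => 1 / x t) (uIcc 0 t) := by
    rw [hu]
    refine LipschitzOnWith.of_dist_le_mul fun a ha b hb => ?_
    rw [Real.coe_toNNReal _ (by positivity), Real.dist_eq, Real.dist_eq]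
    have h1 := hpos a ha.1
    have h2 := hpos b hb.1
    have h3 : x s₀ ≤ x a := hmin ha
    have h4 : x s₀ ≤ x b := hmin hb
    rw [show 1 / x a - 1 / x b = (x b - x a) / (x a * x b) by field_simp, abs_div,
      abs_of_pos (mul_pos h1 h2)]
    have h5 := h.abs_sub_le hK ha.1 hb.1
    rw [abs_sub_comm b a] at h5
    calc |x b - x a| / (x a * x b) ≤ K * |a - b| / (x s₀ * x s₀) := by gcongr
      _ = _ := by ring
  have hftc := hlip.absolutelyContinuousOnInterval.integral_deriv_eq_sub
  have hae := (h.integrable t ht).ae_hasDerivAt_integral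
  have hcongr : ∫ s in (0 : ℝ)..t, deriv (fun t => 1 / x t) s
      = ∫ s in (0 : ℝ)..t, -(φ s / x s ^ 2) := by
    refine intervalIntegral.integral_congr_ae ?_
    have hne : ∀ᵐ s : ℝ, s ≠ t := by simp [ae_iff]
    filter_upwards [hae, hne] with s hs hst hmem
    rw [uIoc_of_le ht] at hmem
    have hslt : s < t := lt_of_le_of_ne hmem.2 hst
    have hd := hs (by rw [hu]; exact ⟨hmem.1.le, hmem.2⟩) 0 left_mem_uIcc
    have hd' : HasDerivAt x (φ s) s := by
      refine (hd.const_add (x 0)).congr_of_eventuallyEq ?_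
      filter_upwards [lt_mem_nhds hmem.1] with u hu
      exact h.eq u hu.le
    have := (hd'.fun_inv (hpos s hmem.1.le).ne').deriv
    simp only [one_div]
    rw [this]
    ring
  rw [hcongr] at hftc
  rw [hftc]
  ring

end IsPrimitive

/-! ### Existence for scalar differential equations -/

/-- A monotone real function whose range has no gaps is continuous. -/
theorem continuous_of_monotone_of_ordConnected_range {f : ℝ → ℝ} (hf : Monotone f)
    (hr : (range f).OrdConnected) : Continuous f := by
  have hm : Monotone (rangeFactorization f) := fun a b hab => hf hab
  have : DenselyOrdered (range f) := inferInstance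
  exact continuous_subtype_val.comp
    (hm.continuous_of_surjective rangeFactorization_surjective)

/-- Global solvability of scalar Carathéodory equations with bounded right-hand side that is
uniformly Lipschitz in the state. -/
theorem exists_caratheodory_solution {F : ℝ → ℝ → ℝ} {K L : ℝ}
    (hL : ∀ s x y, |F s x - F s y| ≤ L * |x - y|) (hK : ∀ s x, |F s x| ≤ K)
    (hm : ∀ x : ℝ → ℝ, Continuous x → Measurable fun s => F s (x s)) (x₀ : ℝ) :
    ∃ x : ℝ → ℝ, x 0 = x₀ ∧ IsPrimitive x fun s => F s (x s) := by
  have hL0 : 0 ≤ L := by simpa using (abs_nonneg _).trans (hL 0 1 0)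
  have hK0 : 0 ≤ K := (abs_nonneg _).trans (hK 0 0)
  -- Picard iteration in the weighted unknown z(t) = e^{-Mt} x(t) contracts with constant L/M < 1 on
  -- the whole half-line at once. Times are clamped to `max t 0` so that z is a bounded continuous
  -- function on ℝ.
  set M : ℝ := L + 1 with hM
  have hM0 : 0 < M := by positivity
  have hint : ∀ x : ℝ → ℝ, Continuous x →
      ∀ a b, IntervalIntegrable (fun s => F s (x s)) volume a b :=
    fun x hx a b => (intervalIntegrable_const (c := K)).mono_fun' (hm x hx).aestronglyMeasurable
      (Eventually.of_forall fun s => hK s _)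
  have hz : ∀ z : BoundedContinuousFunction ℝ ℝ, Continuous fun s => Real.exp (M * s) * z s :=
    fun z => by fun_prop
  let P : BoundedContinuousFunction ℝ ℝ → ℝ → ℝ := fun z t =>
    Real.exp (-(M * max t 0)) * (x₀ + ∫ s in (0 : ℝ)..max t 0, F s (Real.exp (M * s) * z s))
  have hPc : ∀ z, Continuous (P z) := fun z =>
    (by fun_prop : Continuous fun t : ℝ => Real.exp (-(M * max t 0))).mul
      (continuous_const.add ((intervalIntegral.continuous_primitive (hint _ (hz z)) 0).comp
        (continuous_id.max continuous_const)))
  have hPb : ∀ z t, ‖P z t‖ ≤ |x₀| + K := by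
    intro z t
    have ht : (0 : ℝ) ≤ max t 0 := le_max_right _ _
    have h1 : |∫ s in (0 : ℝ)..max t 0, F s (Real.exp (M * s) * z s)| ≤ K * max t 0 := by
      have := intervalIntegral.norm_integral_le_of_norm_le_const (a := 0) (b := max t 0)
        (C := K) (f := fun s => F s (Real.exp (M * s) * z s)) fun s _ => hK s _
      simpa [abs_of_nonneg ht] using this
    have h2 : Real.exp (-(M * max t 0)) * max t 0 ≤ 1 := by
      rw [Real.exp_neg, inv_mul_le_iff₀ (Real.exp_pos _), mul_one]
      nlinarith [Real.add_one_le_exp (M * max t 0)]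
    have h3 : Real.exp (-(M * max t 0)) ≤ 1 := Real.exp_le_one_iff.2 (by nlinarith)
    have h4 := Real.exp_pos (-(M * max t 0))
    rw [Real.norm_eq_abs, abs_mul, abs_of_pos h4]
    calc _ ≤ Real.exp (-(M * max t 0)) * (|x₀| + K * max t 0) := by
          gcongr
          exact (abs_add_le _ _).trans (by gcongr)
      _ = Real.exp (-(M * max t 0)) * |x₀| + K * (Real.exp (-(M * max t 0)) * max t 0) := by ring
      _ ≤ 1 * |x₀| + K * 1 := by gcongr
      _ = _ := by ring
  let Φ : BoundedContinuousFunction ℝ ℝ → BoundedContinuousFunction ℝ ℝ := fun z =>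
    BoundedContinuousFunction.ofNormedAddCommGroup (P z) (hPc z) _ (hPb z)
  have hcontr : ContractingWith (Real.toNNReal (L / M)) Φ := by
    refine ⟨by rw [Real.toNNReal_lt_one, div_lt_one hM0]; linarith,
      LipschitzWith.of_dist_le_mul fun z w => ?_⟩
    rw [Real.coe_toNNReal _ (by positivity)]
    refine (BoundedContinuousFunction.dist_le (by positivity)).2 fun t => ?_
    have ht : (0 : ℝ) ≤ max t 0 := le_max_right _ _
    set D := dist z w
    have hD : 0 ≤ D := dist_nonneg
    have h4 := Real.exp_pos (-(M * max t 0))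
    change dist (P z t) (P w t) ≤ _
    have h1 : |∫ s in (0 : ℝ)..max t 0,
        (F s (Real.exp (M * s) * z s) - F s (Real.exp (M * s) * w s))|
        ≤ ∫ s in (0 : ℝ)..max t 0, L * D * Real.exp (M * s) := by
      refine intervalIntegral.norm_integral_le_of_norm_le (μ := volume)
        (f := fun s => F s (Real.exp (M * s) * z s) - F s (Real.exp (M * s) * w s)) ht ?_
        ((by fun_prop : Continuous fun s : ℝ => L * D * Real.exp (M * s)).intervalIntegrable _ _)
      refine Eventually.of_forall fun s _ => (hL _ _ _).trans ?_
      rw [← mul_sub, abs_mul, abs_of_pos (Real.exp_pos _)]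
      have : |z s - w s| ≤ D := BoundedContinuousFunction.dist_coe_le_dist (f := z) (g := w) s
      calc _ ≤ L * (Real.exp (M * s) * D) := by gcongr
        _ = _ := by ring
    have h2 : ∫ s in (0 : ℝ)..max t 0, L * D * Real.exp (M * s)
        = L * D * ((Real.exp (M * max t 0) - 1) / M) := by
      rw [intervalIntegral.integral_const_mul, intervalIntegral.integral_comp_mul_left _ hM0.ne',
        integral_exp]
      rw [smul_eq_mul, mul_zero, Real.exp_zero]
      ring
    rw [Real.dist_eq, ← mul_sub, abs_mul, abs_of_pos h4, add_sub_add_left_eq_sub,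
      ← intervalIntegral.integral_sub (hint _ (hz z) _ _) (hint _ (hz w) _ _)]
    calc _ ≤ Real.exp (-(M * max t 0)) * (L * D * ((Real.exp (M * max t 0) - 1) / M)) := by
          gcongr; exact h1.trans_eq h2
      _ = L / M * D * (1 - Real.exp (-(M * max t 0))) := by
          rw [Real.exp_neg]; field_simp
      _ ≤ L / M * D * 1 := by gcongr; linarith
      _ = _ := mul_one _
  set z := hcontr.fixedPoint
  have hfix : ∀ t, P z t = z t := fun t =>
    DFunLike.congr_fun (hcontr.fixedPoint_isFixedPt : Φ z = z) t
  have hx : ∀ t, 0 ≤ t → Real.exp (M * t) * z t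
      = x₀ + ∫ s in (0 : ℝ)..t, F s (Real.exp (M * s) * z s) := by
    intro t ht
    rw [← hfix t]
    simp only [P, max_eq_left ht]
    rw [← mul_assoc, ← Real.exp_add]
    simp
  have hx0 : Real.exp (M * 0) * z 0 = x₀ := by simpa using hx 0 le_rfl
  refine ⟨fun s => Real.exp (M * s) * z s, hx0, (hz z).continuousOn, fun t _ => hint _ (hz z) _ _,
    fun t ht => ?_⟩
  simp only [hx0]
  exact hx t ht

/-- Solvability on `[0,∞)` of the autonomous equation `x' = g(x)` for a continuous decreasing `g`
that points inwards at the end points of `[0,b]`. -/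
theorem exists_solution_of_antitoneOn {g : ℝ → ℝ} {b : ℝ} (hb : 0 ≤ b)
    (hg : ContinuousOn g (Icc 0 b)) (hanti : AntitoneOn g (Icc 0 b)) (h0 : 0 ≤ g 0) (hgb : g b ≤ 0)
    {x₀ : ℝ} (hx₀ : x₀ ∈ Icc 0 b) :
    ∃ x : ℝ → ℝ, x 0 = x₀ ∧ (∀ t, 0 ≤ t → x t ∈ Icc 0 b) ∧ IsPrimitive x fun s => g (x s) := by
  let cl : ℝ → ℝ := fun y => projIcc 0 b hb y
  have hcl : ∀ y, cl y ∈ Icc 0 b := fun y => (projIcc 0 b hb y).2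
  have hclm : Monotone cl := fun a c hac => monotone_projIcc hb hac
  have hclc : Continuous cl := continuous_subtype_val.comp continuous_projIcc
  let G : ℝ → ℝ := fun y => g (cl y)
  have hGc : Continuous G := hg.comp_continuous hclc hcl
  have hGa : Antitone G := fun a c hac => hanti (hcl a) (hcl c) (hclm hac)
  obtain ⟨B, hB⟩ := isCompact_Icc.exists_bound_of_continuousOn hg
  let ε : ℕ → ℝ := fun n => 1 / ((n : ℝ) + 1)
  have hε : ∀ n, 0 < ε n := fun n => by positivity
  have hε1 : ∀ n, ε n ≤ 1 := fun n => by
    simp only [ε]; rw [div_le_one (by positivity)]; linarith [(Nat.cast_nonneg n : (0 : ℝ) ≤ n)]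
  have hε0 : Tendsto ε atTop (𝓝 0) := tendsto_one_div_add_atTop_nhds_zero_nat
  -- Polynomials are Lipschitz on [0,b], so each approximating equation has a solution. Monotonicity
  -- of g makes these solutions converge.
  choose p hp using fun n => exists_polynomial_near_of_continuousOn 0 b g hg (ε n) (hε n)
  have hGn : ∀ n y, |(p n).eval (cl y) - G y| < ε n := fun n y => hp n _ (hcl y)
  have hbd : ∀ n y, |(p n).eval (cl y)| ≤ B + 1 := by
    intro n y
    have h1 : |G y| ≤ B := hB _ (hcl y)
    have h2 := hGn n y
    have h3 := hε1 n
    rw [abs_lt] at h2; rw [abs_le] at h1 ⊢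
    constructor <;> linarith [h1.1, h1.2, h2.1, h2.2]
  have hsol : ∀ n, ∃ x : ℝ → ℝ, x 0 = x₀ ∧ IsPrimitive x fun s => (p n).eval (cl (x s)) := by
    intro n
    obtain ⟨L, hL⟩ := (by simpa using (p n).contDiff_aeval (𝕜 := ℝ) 1 :
      ContDiff ℝ 1 fun y => (p n).eval y).contDiffOn |>.exists_lipschitzOnWith (by decide)
      (convex_Icc 0 b) isCompact_Icc
    refine exists_caratheodory_solution (F := fun _ y => (p n).eval (cl y)) (L := L)
      (fun _ y z => ?_) (fun _ y => hbd n y)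
      (fun y hy => ((p n).continuous.comp (hclc.comp hy)).measurable) x₀
    have h1 := hL.dist_le_mul _ (hcl y) _ (hcl z)
    rw [Real.dist_eq, Real.dist_eq] at h1
    exact h1.trans (mul_le_mul_of_nonneg_left (abs_projIcc_sub_projIcc hb) L.2)
  choose x hx0 hx using hsol
  -- Where x n exceeds x k, the decreasing G contributes a nonpositive amount to the growth of the
  -- difference, so only the approximation errors accumulate.
  have hone : ∀ n k t, 0 ≤ t → x n t - x k t ≤ (ε n + ε k) * t := by
    intro n k t ht
    have hlin : IsPrimitive (fun t => (ε n + ε k) * t) (fun _ => ε n + ε k) :=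
      IsPrimitive.of_hasDerivAt (fun t => by simpa using (hasDerivAt_id t).const_mul (ε n + ε k))
        continuous_const
    have := (hlin.sub ((hx n).sub (hx k))).nonneg (T := t) le_rfl (by simp [hx0]) ?_ t ⟨ht, le_rfl⟩
    · linarith
    · intro s hs hneg
      have h1 : 0 ≤ (ε n + ε k) * s := mul_nonneg (by linarith [hε n, hε k]) hs.1
      have h2 : G (x n s) ≤ G (x k s) := hGa (by linarith)
      have h3 := abs_lt.1 (hGn n (x n s))
      have h4 := abs_lt.1 (hGn k (x k s))
      rw [zero_mul]
      linarith [h3.1, h3.2, h4.1, h4.2]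
  have hcau : ∀ t, 0 ≤ t → CauchySeq fun n => x n t := by
    intro t ht
    refine cauchySeq_of_le_tendsto_0' (fun n => 2 * ε n * t) (fun n k hnk => ?_)
      (by simpa using (hε0.const_mul 2).mul_const t)
    have hle : ε k ≤ ε n := by simp only [ε]; gcongr
    have h1 := hone n k t ht
    have h2 := hone k n t ht
    rw [Real.dist_eq, abs_le]
    constructor <;> nlinarith
  have hlim : ∀ t : ℝ, ∃ y, Tendsto (fun n => x n (max t 0)) atTop (𝓝 y) := fun t =>
    cauchySeq_tendsto_of_complete (hcau _ (le_max_right _ _))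
  choose X hX using hlim
  have hX' : ∀ t, 0 ≤ t → Tendsto (fun n => x n t) atTop (𝓝 (X t)) := by
    intro t ht; simpa [max_eq_left ht] using hX t
  have hB0 : 0 ≤ B + 1 := (abs_nonneg _).trans (hbd 0 0)
  have hXc : Continuous X := by
    refine (LipschitzWith.of_dist_le_mul (K := Real.toNNReal (B + 1)) fun s t => ?_).continuous
    rw [Real.coe_toNNReal _ hB0]
    refine le_of_tendsto ((hX s).dist (hX t)) (Eventually.of_forall fun n => ?_)
    refine ((hx n).abs_sub_le (fun u _ => hbd n _) (le_max_right _ _) (le_max_right _ _)).trans ?_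
    gcongr
    exact (abs_max_sub_max_le_abs s t 0)
  have hX0 : X 0 = x₀ := tendsto_nhds_unique (hX' 0 le_rfl) (by simp [hx0])
  have hprim : IsPrimitive X fun s => G (X s) := by
    refine ⟨hXc.continuousOn, fun t _ => (hGc.comp hXc).intervalIntegrable _ _, fun t ht => ?_⟩
    have h1 : Tendsto (fun n => ∫ s in (0 : ℝ)..t, (p n).eval (cl (x n s))) atTop
        (𝓝 (∫ s in (0 : ℝ)..t, G (X s))) := by
      refine intervalIntegral.tendsto_integral_filter_of_dominated_convergence (fun _ => B + 1)
        (Eventually.of_forall fun n => ?_) (Eventually.of_forall fun n =>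
          Eventually.of_forall fun s _ => hbd n _) (by simp) (Eventually.of_forall fun s hs => ?_)
      · exact (((hx n).integrable t ht).def').aestronglyMeasurable
      · rw [uIoc_of_le ht] at hs
        have h2 : Tendsto (fun n => G (x n s)) atTop (𝓝 (G (X s))) :=
          (hGc.tendsto _).comp (hX' s hs.1.le)
        have h3 : Tendsto (fun n => (p n).eval (cl (x n s)) - G (x n s)) atTop (𝓝 0) :=
          squeeze_zero_norm (fun n => (hGn n _).le) hε0
        simpa using h3.add h2
    refine tendsto_nhds_unique (hX' t ht) ?_
    rw [hX0]
    refine (h1.const_add x₀).congr fun n => ?_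
    rw [(hx n).eq t ht, hx0]
  have hlow : ∀ t, 0 ≤ t → 0 ≤ X t := fun t ht =>
    hprim.nonneg (T := t) le_rfl (hX0 ▸ hx₀.1) (fun s _ hneg => by
      have : cl (X s) = 0 := by simp [cl, projIcc_of_le_left hb hneg.le]
      simpa [G, this] using h0) t ⟨ht, le_rfl⟩
  have hupp : ∀ t, 0 ≤ t → X t ≤ b := fun t ht => by
    have := ((IsPrimitive.const b).sub hprim).nonneg (T := t) le_rfl (by simpa [hX0] using hx₀.2)
      (fun s _ hneg => by
        have : cl (X s) = b := by simp [cl, projIcc_of_right_le hb (by linarith : b ≤ X s)]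
        simpa [G, this] using hgb) t ⟨ht, le_rfl⟩
    linarith
  have hcl' : ∀ t, 0 ≤ t → G (X t) = g (X t) := fun t ht => by
    simp only [G, cl, projIcc_of_mem hb ⟨hlow t ht, hupp t ht⟩]
  refine ⟨X, hX0, fun t ht => ⟨hlow t ht, hupp t ht⟩, hXc.continuousOn, fun t ht => ?_,
    fun t ht => ?_⟩
  · refine (hprim.integrable t ht).congr fun s hs => hcl' s ?_
    rw [uIoc_of_le ht] at hs; exact hs.1.le
  · rw [hprim.eq t ht]
    congr 1
    refine intervalIntegral.integral_congr fun s hs => hcl' s ?_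
    rw [uIcc_of_le ht] at hs; exact hs.1

theorem IsPrimitive.shift {x φ : ℝ → ℝ} (hx : IsPrimitive x φ) {t : ℝ} (ht : 0 ≤ t) :
    IsPrimitive (fun s => x (s + t)) (fun s => φ (s + t)) where
  cont := hx.cont.comp (by fun_prop) fun s (hs : 0 ≤ s) => (by positivity : (0 : ℝ) ≤ s + t)
  integrable s hs := by
    have := (hx.integrable' ht (by positivity : 0 ≤ s + t)).comp_add_right t
    simpa using this
  eq s hs := by
    rw [intervalIntegral.integral_comp_add_right (fun u => φ u),
      ← hx.sub_eq (by simpa using ht) (by positivity : 0 ≤ s + t)]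
    simp

/-! ### Conditional variance paths -/

namespace Model

variable (m : Model) {c : ℝ → ℝ}

theorem γmax_pos : 0 < m.γmax := by
  refine lt_of_le_of_lt ?_ m.γmax_gt
  have h1 : m.lam * m.σ₁ ^ 2 ≤ √(m.lam ^ 2 * m.σ₁ ^ 4 + m.σ₁ ^ 2 * m.σ₂ ^ 2) := by
    apply Real.le_sqrt_of_sq_le
    nlinarith [mul_nonneg (sq_nonneg m.σ₁) (sq_nonneg m.σ₂)]
  linarith

/-- Multiplying by σ₁² and completing the square shows that `γmax` lies beyond the positive root of
f(·, 0). Paths therefore cannot leave through the upper end. -/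
theorem f_γmax_neg : m.f m.γmax 0 < 0 := by
  have hs := m.σ₁_pos
  have h1 : √(m.lam ^ 2 * m.σ₁ ^ 4 + m.σ₁ ^ 2 * m.σ₂ ^ 2) < m.γmax + m.lam * m.σ₁ ^ 2 := by
    linarith [m.γmax_gt]
  have h2 : 0 < m.γmax + m.lam * m.σ₁ ^ 2 := (Real.sqrt_nonneg _).trans_lt h1
  rw [Real.sqrt_lt' h2] at h1
  have h3 : m.f m.γmax 0 * m.σ₁ ^ 2
      = m.lam ^ 2 * m.σ₁ ^ 4 + m.σ₁ ^ 2 * m.σ₂ ^ 2 - (m.γmax + m.lam * m.σ₁ ^ 2) ^ 2 := by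
    simp only [f]
    field_simp
    ring
  have h4 : 0 < m.σ₁ ^ 2 := by positivity
  by_contra! hn
  nlinarith [mul_nonneg hn h4.le]

theorem a₁_pos : 0 < m.a₁ := by
  have h := mul_pos m.κ_pos m.ρ_pos
  have : m.δ * m.ρ < √(m.δ ^ 2 * m.ρ ^ 2 + 4 * m.κ * m.ρ) := by
    apply Real.lt_sqrt_of_sq_lt
    nlinarith
  simp only [a₁]
  linarith

theorem aBar_pos : 0 < m.aBar := by
  have h1 := m.a₁_pos
  have h2 := m.ρ_pos
  have h3 := m.δ_pos
  have h4 := m.lam_nonneg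
  have h5 : 0 < m.a₃ := by simp only [a₃]; positivity
  -- The factor 2λ + δ cancels between `a₂` and `aBar`.
  have h6 : m.aBar = m.a₃ ^ 2 / (2 * m.ρ) := by
    simp only [aBar, a₂]
    field_simp
    ring
  rw [h6]
  positivity

variable {m}

theorem f_anti {x y h : ℝ} (hx : 0 ≤ x) (hxy : x ≤ y) (hh : 0 ≤ h) : m.f y h ≤ m.f x h := by
  have h1 : x ^ 2 ≤ y ^ 2 := by gcongr
  have h2 := m.lam_nonneg
  have h3 : 0 ≤ (1 / m.σ₁) ^ 2 + h := by positivity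
  simp only [f]
  nlinarith [mul_nonneg h3 (sub_nonneg.2 h1), mul_nonneg h2 (sub_nonneg.2 hxy)]

variable (m c) in
/-- A Lipschitz constant of `f` in the state. -/
noncomputable def stateLip : ℝ := 2 * ((1 / m.σ₁) ^ 2 + m.hMax c) * m.γmax + 2 * m.lam

variable (m c) in
/-- A bound of the speed `f`. -/
noncomputable def speed : ℝ :=
  ((1 / m.σ₁) ^ 2 + m.hMax c) * m.γmax ^ 2 + 2 * m.lam * m.γmax + m.σ₂ ^ 2

theorem stateLip_nonneg : 0 ≤ m.stateLip c := by
  have h1 := m.lam_nonneg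
  have h2 := m.γmax_pos
  have h3 := m.hMax_nonneg c
  simp only [stateLip]
  positivity

theorem abs_f_le {x h : ℝ} (hx : x ∈ Icc 0 m.γmax) (hh : h ∈ Icc 0 (m.hMax c)) :
    |m.f x h| ≤ m.speed c := by
  have h1 := m.lam_nonneg
  have h2 : 0 ≤ (1 / m.σ₁) ^ 2 + h := add_nonneg (by positivity) hh.1
  have h3 : ((1 / m.σ₁) ^ 2 + h) * x ^ 2 ≤ ((1 / m.σ₁) ^ 2 + m.hMax c) * m.γmax ^ 2 := by
    have := hx.1; have := hx.2; have := hh.2; have := hh.1; have := m.hMax_nonneg c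
    gcongr
  have h4 : 0 ≤ ((1 / m.σ₁) ^ 2 + h) * x ^ 2 := by positivity
  have h5 : 2 * m.lam * x ≤ 2 * m.lam * m.γmax := by have := hx.2; gcongr
  have h6 : 0 ≤ 2 * m.lam * x := mul_nonneg (by positivity) hx.1
  have h7 := sq_nonneg m.σ₂
  simp only [f, speed]
  rw [abs_le]
  constructor <;> nlinarith

theorem abs_f_sub_le {x y h : ℝ} (hx : x ∈ Icc 0 m.γmax) (hy : y ∈ Icc 0 m.γmax)
    (hh : h ∈ Icc 0 (m.hMax c)) : |m.f x h - m.f y h| ≤ m.stateLip c * |x - y| := by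
  have h1 := m.lam_nonneg
  have h2 := hx.1; have h3 := hy.1; have h4 := hx.2; have h5 := hy.2
  have h7 := hh.1
  have h6 : m.f x h - m.f y h = -((((1 / m.σ₁) ^ 2 + h) * (x + y) + 2 * m.lam) * (x - y)) := by
    simp only [f]; ring
  rw [h6, abs_neg, abs_mul, abs_of_nonneg (by positivity)]
  gcongr
  simp only [stateLip]
  have : ((1 / m.σ₁) ^ 2 + h) * (x + y) ≤ ((1 / m.σ₁) ^ 2 + m.hMax c) * (m.γmax + m.γmax) := by
    have := hh.2; have := m.hMax_nonneg c
    gcongr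
  linarith

variable (m c) in
/-- `γ` is a conditional variance path with values in `[0,γmax]` under the admissible rate `h`. -/
structure IsPath (h γ : ℝ → ℝ) : Prop where
  adm : m.Admissible c h
  prim : IsPrimitive γ fun s => m.f (γ s) (h s)
  mem : ∀ t, 0 ≤ t → γ t ∈ Icc 0 m.γmax

theorem IsPath.isState {h γ : ℝ → ℝ} (hp : m.IsPath c h γ) : m.IsState h (γ 0) γ :=
  ⟨hp.prim.cont, hp.prim.eq⟩

/-- `IsState` asks neither for integrability of the drift nor for a range of the state.
Integrability follows from continuity of γ and boundedness of h; the range follows by comparison,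
since the drift is nonnegative at 0 and negative at `γmax`. -/
theorem IsState.isPath {h γ : ℝ → ℝ} {γ₀ : ℝ} (hs : m.IsState h γ₀ γ) (ha : m.Admissible c h)
    (hγ₀ : γ₀ ∈ Icc 0 m.γmax) : γ 0 = γ₀ ∧ m.IsPath c h γ := by
  have h0 : γ 0 = γ₀ := by simpa using hs.2 0 le_rfl
  have hbd : ∀ t, 0 ≤ t → ∃ B, 0 ≤ B ∧ ∀ s ∈ Icc 0 t, |γ s| ≤ B := by
    intro t ht
    obtain ⟨B, hB⟩ := isCompact_Icc.exists_bound_of_continuousOn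
      (hs.1.mono (fun u hu => hu.1 : Icc 0 t ⊆ Ici 0))
    exact ⟨B, (norm_nonneg _).trans (hB 0 ⟨le_rfl, ht⟩), hB⟩
  have hprim : IsPrimitive γ fun s => m.f (γ s) (h s) := by
    refine ⟨hs.1, fun t ht => ?_, fun t ht => by rw [h0]; exact hs.2 t ht⟩
    obtain ⟨B, hB0, hB⟩ := hbd t ht
    have hl := m.lam_nonneg
    have hA := m.hMax_nonneg c
    refine (intervalIntegrable_const
      (c := ((1 / m.σ₁) ^ 2 + m.hMax c) * B ^ 2 + 2 * m.lam * B + m.σ₂ ^ 2)).mono_fun' ?_ ?_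
    · rw [uIoc_of_le ht]
      have h1 : AEMeasurable γ (volume.restrict (Ioc 0 t)) :=
        (hs.1.mono fun u hu => hu.1.le : ContinuousOn γ (Ioc 0 t)).aemeasurable measurableSet_Ioc
      have h2 : AEMeasurable h (volume.restrict (Ioc 0 t)) := ha.1.aemeasurable
      refine AEMeasurable.aestronglyMeasurable ?_
      simp only [f]
      fun_prop
    · rw [uIoc_of_le ht]
      refine (ae_restrict_iff' measurableSet_Ioc).2 (Eventually.of_forall fun s hs' => ?_)
      have h1 := hB s ⟨hs'.1.le, hs'.2⟩
      have h2 := ha.2 s hs'.1.le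
      have h3 : γ s ^ 2 ≤ B ^ 2 := by rw [← sq_abs]; gcongr
      have h4 : 0 ≤ (1 / m.σ₁) ^ 2 + h s := add_nonneg (by positivity) h2.1
      have h5 : ((1 / m.σ₁) ^ 2 + h s) * γ s ^ 2 ≤ ((1 / m.σ₁) ^ 2 + m.hMax c) * B ^ 2 := by
        have := h2.2
        gcongr
      have h6 := abs_le.1 h1
      have h7 : 0 ≤ ((1 / m.σ₁) ^ 2 + h s) * γ s ^ 2 := by positivity
      have h8 := sq_nonneg m.σ₂
      simp only [f, Real.norm_eq_abs]
      rw [abs_le]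
      constructor <;> nlinarith [h6.1, h6.2]
  have hlow : ∀ t, 0 ≤ t → 0 ≤ γ t := by
    intro t ht
    obtain ⟨B, hB0, hB⟩ := hbd t ht
    have hA := m.hMax_nonneg c
    refine hprim.nonneg (T := t) (K := ((1 / m.σ₁) ^ 2 + m.hMax c) * B) (by positivity)
      (by rw [h0]; exact hγ₀.1) (fun s hs' hneg => ?_) t ⟨ht, le_rfl⟩
    have h1 := (abs_le.1 (hB s hs')).1
    have h2 := ha.2 s hs'.1
    have h3 := m.lam_nonneg
    have h5 : ((1 / m.σ₁) ^ 2 + h s) * γ s ^ 2 ≤ ((1 / m.σ₁) ^ 2 + m.hMax c) * (B * -γ s) := by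
      have := h2.2
      have := h2.1
      gcongr
      nlinarith
    simp only [f]
    nlinarith [mul_nonneg h3 (neg_nonneg.2 hneg.le), sq_nonneg m.σ₂]
  have hupp : ∀ t, 0 ≤ t → γ t ≤ m.γmax := by
    intro t ht
    have := ((IsPrimitive.const m.γmax).sub hprim).nonneg (T := t) le_rfl
      (by rw [h0]; linarith [hγ₀.2]) (fun s hs' hneg => ?_) t ⟨ht, le_rfl⟩
    · linarith
    · have h2 := (ha.2 s hs'.1).1
      have h3 : m.f (γ s) (h s) ≤ m.f (γ s) 0 := by
        simp only [f]; nlinarith [mul_nonneg h2 (sq_nonneg (γ s))]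
      have h4 : m.f (γ s) 0 ≤ m.f m.γmax 0 := f_anti m.γmax_pos.le (by linarith) le_rfl
      linarith [m.f_γmax_neg]
  exact ⟨h0, ha, hprim, fun t ht => ⟨hlow t ht, hupp t ht⟩⟩

/-- Clamping state and rate makes the drift bounded and Lipschitz. The solution never leaves [0,
γmax], so the clamps are inactive along it. -/
theorem exists_path {h : ℝ → ℝ} (ha : m.Admissible c h) {γ₀ : ℝ} (hγ₀ : γ₀ ∈ Icc 0 m.γmax) :
    ∃ γ, γ 0 = γ₀ ∧ m.IsPath c h γ := by
  let k : ℝ → ℝ := fun s => projIcc 0 _ (m.hMax_nonneg c) (h s)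
  let cl : ℝ → ℝ := fun x => projIcc 0 _ m.γmax_pos.le x
  have hk : ∀ s, k s ∈ Icc 0 (m.hMax c) := fun s => (projIcc 0 _ (m.hMax_nonneg c) (h s)).2
  have hcl : ∀ x, cl x ∈ Icc 0 m.γmax := fun x => (projIcc 0 _ m.γmax_pos.le x).2
  have hkm : Measurable k :=
    (continuous_subtype_val.comp continuous_projIcc).measurable.comp ha.1
  have hclc : Continuous cl := continuous_subtype_val.comp continuous_projIcc
  obtain ⟨x, hx0, hx⟩ := exists_caratheodory_solution (F := fun s x => m.f (cl x) (k s))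
    (K := m.speed c) (L := m.stateLip c)
    (fun s x y => (abs_f_sub_le (hcl x) (hcl y) (hk s)).trans
      (mul_le_mul_of_nonneg_left (abs_projIcc_sub_projIcc _) stateLip_nonneg))
    (fun s x => abs_f_le (hcl x) (hk s))
    (fun x hx => by
      have h1 : Measurable fun s => cl (x s) := (hclc.comp hx).measurable
      simp only [f]
      fun_prop) γ₀
  have hlow : ∀ t, 0 ≤ t → 0 ≤ x t := fun t ht =>
    hx.nonneg (T := t) le_rfl (hx0 ▸ hγ₀.1) (fun s _ hneg => by
      have h1 : cl (x s) = 0 := by simp [cl, projIcc_of_le_left m.γmax_pos.le hneg.le]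
      have := sq_nonneg m.σ₂
      simpa [f, h1] using this) t ⟨ht, le_rfl⟩
  have hupp : ∀ t, 0 ≤ t → x t ≤ m.γmax := fun t ht => by
    have := ((IsPrimitive.const m.γmax).sub hx).nonneg (T := t) le_rfl
      (by rw [hx0]; linarith [hγ₀.2]) (fun s _ hneg => by
        have h1 : cl (x s) = m.γmax := by
          simp [cl, projIcc_of_right_le m.γmax_pos.le (by linarith : m.γmax ≤ x s)]
        have h2 := m.f_γmax_neg
        have h3 := mul_nonneg (hk s).1 (sq_nonneg m.γmax)
        simp only [h1, zero_mul]
        simp only [f] at h2 ⊢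
        nlinarith) t ⟨ht, le_rfl⟩
    linarith
  have heq : ∀ t, 0 ≤ t → m.f (cl (x t)) (k t) = m.f (x t) (h t) := fun t ht => by
    simp only [cl, k, projIcc_of_mem _ ⟨hlow t ht, hupp t ht⟩, projIcc_of_mem _ (ha.2 t ht)]
  refine ⟨x, hx0, ha, ⟨hx.cont, fun t ht => (hx.integrable t ht).congr fun s hs => heq s ?_,
    fun t ht => ?_⟩, fun t ht => ⟨hlow t ht, hupp t ht⟩⟩
  · rw [uIoc_of_le ht] at hs; exact hs.1.le
  · rw [hx.eq t ht]
    congr 1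
    refine intervalIntegral.integral_congr fun s hs => heq s ?_
    rw [uIcc_of_le ht] at hs; exact hs.1

namespace IsPath

variable {h k α β γ : ℝ → ℝ}

theorem abs_speed_le (hp : m.IsPath c h γ) (s : ℝ) (hs : 0 ≤ s) :
    |m.f (γ s) (h s)| ≤ m.speed c :=
  abs_f_le (hp.mem s hs) (hp.adm.2 s hs)

theorem shift (hp : m.IsPath c h γ) {t : ℝ} (ht : 0 ≤ t) :
    m.IsPath c (fun s => h (s + t)) (fun s => γ (s + t)) :=
  ⟨⟨hp.adm.1.comp (measurable_id.add_const t), fun s hs => hp.adm.2 _ (by positivity)⟩,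
    hp.prim.shift ht, fun s hs => hp.mem _ (by positivity)⟩

/-- The drift is at least -Kγ, so the path stays above a decaying exponential. This permits passing
to the precision 1/γ. -/
theorem pos (hp : m.IsPath c h γ) (h0 : 0 < γ 0) (t : ℝ) (ht : 0 ≤ t) : 0 < γ t := by
  have hG := m.γmax_pos
  have hA := m.hMax_nonneg c
  have hl := m.lam_nonneg
  set K : ℝ := ((1 / m.σ₁) ^ 2 + m.hMax c) * m.γmax + 2 * m.lam
  have hK : 0 ≤ K := by positivity
  have hexp : IsPrimitive (fun t => γ 0 * Real.exp (-K * t))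
      (fun t => γ 0 * (Real.exp (-K * t) * -K)) :=
    IsPrimitive.of_hasDerivAt (fun t => by
      have := ((hasDerivAt_id t).const_mul (-K)).exp.const_mul (γ 0)
      simpa using this) (by fun_prop)
  have := (hp.prim.sub hexp).nonneg (T := t) hK (by simp) (fun s hs hneg => ?_) t ⟨ht, le_rfl⟩
  · have : 0 < γ 0 * Real.exp (-K * t) := by positivity
    linarith
  · have h1 := hp.mem s hs.1
    have h2 := hp.adm.2 s hs.1
    have h3 : ((1 / m.σ₁) ^ 2 + h s) * γ s ^ 2
        ≤ ((1 / m.σ₁) ^ 2 + m.hMax c) * (m.γmax * γ s) := by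
      have := h2.1; have := h2.2; have := h1.1; have := h1.2
      rw [sq (γ s)]
      gcongr
    have h4 := sq_nonneg m.σ₂
    have h5 : -(K * γ s) ≤ m.f (γ s) (h s) := by simp only [f, K]; nlinarith
    nlinarith [mul_nonneg hK (neg_nonneg.2 hneg.le)]

/-- Under a common rate, paths depend monotonically on the initial variance. -/
theorem le_of_le (hα : m.IsPath c h α) (hβ : m.IsPath c h β) (h0 : α 0 ≤ β 0) (t : ℝ)
    (ht : 0 ≤ t) : α t ≤ β t := by
  have := (hβ.prim.sub hα.prim).nonneg (T := t) le_rfl (by linarith) (fun s hs hneg => ?_) t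
    ⟨ht, le_rfl⟩
  · linarith
  · have := f_anti (m := m) (hβ.mem s hs.1).1 (by linarith : β s ≤ α s) (hα.adm.2 s hs.1).1
    linarith

/-- Under a common rate, the distance of paths does not increase. -/
theorem sub_le_sub (hα : m.IsPath c h α) (hβ : m.IsPath c h β) (h0 : α 0 ≤ β 0) (t : ℝ)
    (ht : 0 ≤ t) : β t - α t ≤ β 0 - α 0 := by
  have := ((IsPrimitive.const (β 0 - α 0)).sub (hβ.prim.sub hα.prim)).nonneg (T := t) le_rfl
    (by simp) (fun s hs _ => ?_) t ⟨ht, le_rfl⟩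
  · linarith
  · have := f_anti (m := m) (hα.mem s hs.1).1 (hα.le_of_le hβ h0 s hs.1) (hα.adm.2 s hs.1).1
    linarith

/-- Under a common rate, paths are concave in the initial variance. -/
theorem concave (hα : m.IsPath c h α) (hβ : m.IsPath c h β) (hγ : m.IsPath c h γ) {a b : ℝ}
    (ha : 0 ≤ a) (hb : 0 ≤ b) (hab : a + b = 1) (h0 : a * α 0 + b * β 0 = γ 0) (t : ℝ)
    (ht : 0 ≤ t) : a * α t + b * β t ≤ γ t := by
  have := (hγ.prim.sub ((hα.prim.const_mul a).add (hβ.prim.const_mul b))).nonneg (T := t) le_rfl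
    (by linarith) (fun s hs hneg => ?_) t ⟨ht, le_rfl⟩
  · linarith
  · have h1 := (hα.adm.2 s hs.1).1
    have h2 := f_anti (m := m) (hγ.mem s hs.1).1
      (by linarith : γ s ≤ a * α s + b * β s) h1
    -- The concavity defect of a quadratic is explicit.
    have h3 : m.f (a * α s + b * β s) (h s) - (a * m.f (α s) (h s) + b * m.f (β s) (h s))
        = ((1 / m.σ₁) ^ 2 + h s) * (a * b * (α s - β s) ^ 2) := by
      obtain rfl : b = 1 - a := by linarith
      simp only [f]; ring
    have h4 : 0 ≤ ((1 / m.σ₁) ^ 2 + h s) * (a * b * (α s - β s) ^ 2) := by positivity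
    linarith

/-- In terms of the conditional precision, paths are concave jointly in the initial precision
and the rate. -/
theorem le_harmonic (hα : m.IsPath c h α) (hβ : m.IsPath c k β) {a b : ℝ} (ha : 0 ≤ a)
    (hb : 0 ≤ b) (hab : a + b = 1) (hγ : m.IsPath c (fun t => a * h t + b * k t) γ)
    (hα0 : 0 < α 0) (hβ0 : 0 < β 0) (h0 : a * (1 / α 0) + b * (1 / β 0) = 1 / γ 0) (t : ℝ)
    (ht : 0 ≤ t) : γ t ≤ 1 / (a * (1 / α t) + b * (1 / β t)) := by
  have hmix : ∀ x y : ℝ, 0 < x → 0 < y → 0 < a * (1 / x) + b * (1 / y) := by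
    intro x y hx hy
    rcases ha.eq_or_lt with rfl | ha'
    · have : b = 1 := by linarith
      subst this; simpa using hy
    · positivity
  have hγ0 : 0 < γ 0 := one_div_pos.1 (h0 ▸ hmix _ _ hα0 hβ0)
  have pα := hα.prim.reciprocal hα.abs_speed_le (hα.pos hα0)
  have pβ := hβ.prim.reciprocal hβ.abs_speed_le (hβ.pos hβ0)
  have pγ := hγ.prim.reciprocal hγ.abs_speed_le (hγ.pos hγ0)
  -- This is the drift of the precision: affine in the rate, concave in 1/x.
  have hf : ∀ x u : ℝ, 0 < x → -(m.f x u / x ^ 2)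
      = (1 / m.σ₁) ^ 2 + u + 2 * m.lam * (1 / x) - m.σ₂ ^ 2 * (1 / x) ^ 2 := by
    intro x u hx
    simp only [f]; field_simp; ring
  have hmα := hα.pos hα0 t ht
  have hmβ := hβ.pos hβ0 t ht
  have hmγ := hγ.pos hγ0 t ht
  -- The rates cancel in the difference of precisions. Where it is negative, the quadratic terms
  -- help, and the linear term leaves the constant 2λ.
  have := (pγ.sub ((pα.const_mul a).add (pβ.const_mul b))).nonneg (T := t) (K := 2 * m.lam)
    (by have := m.lam_nonneg; positivity) (by linarith) (fun s hs hneg => ?_) t ⟨ht, le_rfl⟩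
  · rw [le_one_div hmγ (hmix _ _ hmα hmβ)]
    linarith
  · have h1 := hα.pos hα0 s hs.1
    have h2 := hβ.pos hβ0 s hs.1
    have h3 := hγ.pos hγ0 s hs.1
    rw [hf _ _ h1, hf _ _ h2, hf _ _ h3]
    have h1' := one_div_pos.2 h1
    have h2' := one_div_pos.2 h2
    have h3' := one_div_pos.2 h3
    set x := 1 / α s
    set y := 1 / β s
    set z := 1 / γ s
    have h5 : 0 ≤ (a * x + b * y - z) * (a * x + b * y + z) :=
      mul_nonneg (by linarith) (by positivity)
    have h6 : a * x ^ 2 + b * y ^ 2 = (a * x + b * y) ^ 2 + a * b * (x - y) ^ 2 := by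
      obtain rfl : b = 1 - a := by linarith
      ring
    have h7 : 0 ≤ a * b * (x - y) ^ 2 := by positivity
    have h8 : 0 ≤ m.σ₂ ^ 2 * (a * x ^ 2 + b * y ^ 2 - z ^ 2) :=
      mul_nonneg (sq_nonneg _) (by nlinarith)
    obtain rfl : b = 1 - a := by linarith
    nlinarith

end IsPath

end Model

/-! ### Discounted integrals -/

/-- Bounded measurable functions on `(0,∞)`. -/
structure IsBddMeas (g : ℝ → ℝ) : Prop where
  meas : AEStronglyMeasurable g (volume.restrict (Ioi 0))
  bdd : ∃ B, ∀ t, 0 < t → |g t| ≤ B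

namespace IsBddMeas

variable {f g : ℝ → ℝ}

theorem add (hf : IsBddMeas f) (hg : IsBddMeas g) : IsBddMeas fun t => f t + g t := by
  obtain ⟨A, hA⟩ := hf.bdd
  obtain ⟨B, hB⟩ := hg.bdd
  exact ⟨hf.meas.add hg.meas, A + B, fun t ht =>
    (abs_add_le _ _).trans (add_le_add (hA t ht) (hB t ht))⟩

theorem const_mul (a : ℝ) (hf : IsBddMeas f) : IsBddMeas fun t => a * f t := by
  obtain ⟨A, hA⟩ := hf.bdd
  exact ⟨hf.meas.const_mul a, |a| * A, fun t ht => by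
    rw [abs_mul]; exact mul_le_mul_of_nonneg_left (hA t ht) (abs_nonneg a)⟩

theorem const (a : ℝ) : IsBddMeas fun _ => a :=
  ⟨aestronglyMeasurable_const, |a|, fun _ _ => le_rfl⟩

theorem of_continuousOn (hf : ContinuousOn f (Ioi 0)) {B : ℝ} (hB : ∀ t, 0 < t → |f t| ≤ B) :
    IsBddMeas f :=
  ⟨hf.aestronglyMeasurable measurableSet_Ioi, B, hB⟩

theorem intervalIntegrable (hg : IsBddMeas g) {t : ℝ} (ht : 0 ≤ t) :
    IntervalIntegrable g volume 0 t := by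
  obtain ⟨B, hB⟩ := hg.bdd
  refine (intervalIntegrable_const (c := B)).mono_fun' ?_ ?_
  · rw [uIoc_of_le ht]
    exact hg.meas.mono_measure (Measure.restrict_mono Ioc_subset_Ioi_self le_rfl)
  · rw [uIoc_of_le ht]
    exact (ae_restrict_iff' measurableSet_Ioc).2 (Eventually.of_forall fun s hs => hB s hs.1)

end IsBddMeas

theorem IsCost.continuousOn {c : ℝ → ℝ} (hc : IsCost c) : ContinuousOn c (Ici 0) :=
  hc.contDiff_one.continuousOn

namespace Model

variable {m : Model} {c f g : ℝ → ℝ}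

variable (m) in
/-- The discounted integral of a function. -/
noncomputable def disc (g : ℝ → ℝ) : ℝ := ∫ t in Ioi (0 : ℝ), Real.exp (-m.δ * t) * g t

theorem integrableOn_exp : IntegrableOn (fun t => Real.exp (-m.δ * t)) (Ioi 0) :=
  exp_neg_integrableOn_Ioi 0 m.δ_pos

theorem integrableOn_disc (hg : IsBddMeas g) :
    IntegrableOn (fun t => Real.exp (-m.δ * t) * g t) (Ioi 0) := by
  obtain ⟨B, hB⟩ := hg.bdd
  refine (integrableOn_exp (m := m)).mul_bdd (c := B) hg.meas ?_
  exact (ae_restrict_iff' measurableSet_Ioi).2 (Eventually.of_forall hB)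

theorem disc_mono (hf : IsBddMeas f) (hg : IsBddMeas g) (h : ∀ t, 0 < t → f t ≤ g t) :
    m.disc f ≤ m.disc g :=
  setIntegral_mono_on (integrableOn_disc hf) (integrableOn_disc hg) measurableSet_Ioi
    fun t ht => mul_le_mul_of_nonneg_left (h t ht) (Real.exp_pos _).le

theorem disc_add (hf : IsBddMeas f) (hg : IsBddMeas g) :
    m.disc (fun t => f t + g t) = m.disc f + m.disc g := by
  simp only [disc, mul_add]
  exact integral_add (integrableOn_disc hf) (integrableOn_disc hg)

theorem disc_const_mul (a : ℝ) : m.disc (fun t => a * f t) = a * m.disc f := by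
  simp only [disc, mul_left_comm _ a]
  exact integral_const_mul _ _

theorem disc_const (a : ℝ) : m.disc (fun _ => a) = a / m.δ := by
  have h := integral_exp_mul_Ioi (neg_lt_zero.2 m.δ_pos) 0
  simp only [disc, integral_mul_const, h]
  simp
  ring

theorem disc_nonneg (hf : ∀ t, 0 < t → 0 ≤ f t) : 0 ≤ m.disc f :=
  setIntegral_nonneg measurableSet_Ioi fun t ht => mul_nonneg (Real.exp_pos _).le (hf t ht)

theorem disc_lt (hf : IsBddMeas f) (hg : IsBddMeas g) (h : ∀ t, 0 < t → f t ≤ g t) {τ : ℝ}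
    (hτ : 0 < τ) (hlt : ∀ t, 0 < t → t < τ → f t < g t) : m.disc f < m.disc g := by
  have hd : IsBddMeas fun t => g t + -1 * f t := hg.add (hf.const_mul (-1))
  have hpos : 0 < m.disc fun t => g t + -1 * f t := by
    refine (setIntegral_pos_iff_support_of_nonneg_ae ?_ (integrableOn_disc hd)).2 ?_
    · exact (ae_restrict_iff' measurableSet_Ioi).2 (Eventually.of_forall fun t ht =>
        mul_nonneg (Real.exp_pos _).le (by linarith [h t ht]))
    · refine lt_of_lt_of_le ?_ (measure_mono (?_ : Ioo 0 τ ⊆ _))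
      · simpa using hτ
      · intro t ht
        refine ⟨?_, ht.1⟩
        exact (mul_pos (Real.exp_pos _) (by linarith [hlt t ht.1 ht.2])).ne'
  rw [disc_add hg (hf.const_mul (-1)), disc_const_mul] at hpos
  linarith

/-- Splitting the discounted integral of a nonnegative function at time `t`. -/
theorem le_disc (hg : IsBddMeas g) (h0 : ∀ s, 0 < s → 0 ≤ g s) {t : ℝ} (ht : 0 ≤ t) :
    Real.exp (-m.δ * t) * ((∫ s in (0 : ℝ)..t, g s) + m.disc fun s => g (s + t)) ≤ m.disc g := by
  have hi := integrableOn_disc (m := m) hg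
  have hgi := hg.intervalIntegrable ht
  have hii : IntervalIntegrable (fun s => Real.exp (-m.δ * s) * g s) volume 0 t := by
    rw [intervalIntegrable_iff_integrableOn_Ioc_of_le ht]
    exact hi.mono_set Ioc_subset_Ioi_self
  have h1 : m.disc g = (∫ s in (0 : ℝ)..t, Real.exp (-m.δ * s) * g s)
      + ∫ s in Ioi t, Real.exp (-m.δ * s) * g s :=
    (intervalIntegral.integral_interval_add_Ioi hi (hi.mono_set (Ioi_subset_Ioi ht))).symm
  have h2 : ∫ s in Ioi t, Real.exp (-m.δ * s) * g s
      = Real.exp (-m.δ * t) * m.disc fun s => g (s + t) := by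
    rw [← (measurePreserving_add_right volume t).setIntegral_preimage_emb
      (measurableEmbedding_addRight t) (fun s => Real.exp (-m.δ * s) * g s) (Ioi t)]
    simp only [preimage_add_const_Ioi, sub_self, disc]
    rw [← integral_const_mul]
    congr 1
    ext s
    rw [mul_add, Real.exp_add]
    ring
  -- Replacing e^{-δs} by the smaller e^{-δt} loses only O(t²), which is negligible in the limit of
  -- small t taken in `hjb_le`.
  have h3 : Real.exp (-m.δ * t) * (∫ s in (0 : ℝ)..t, g s)
      ≤ ∫ s in (0 : ℝ)..t, Real.exp (-m.δ * s) * g s := by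
    rw [← intervalIntegral.integral_const_mul]
    refine intervalIntegral.integral_mono_on_of_le_Ioo ht (hgi.const_mul _) hii fun s hs => ?_
    refine mul_le_mul_of_nonneg_right (Real.exp_le_exp.2 ?_) (h0 s hs.1)
    nlinarith [m.δ_pos, hs.2]
  rw [h1, h2, mul_add]
  linarith

namespace IsPath

variable {h k α β γ : ℝ → ℝ}

theorem isBddMeas_state (hp : m.IsPath c h γ) : IsBddMeas γ :=
  .of_continuousOn (hp.prim.cont.mono Ioi_subset_Ici_self) (B := m.γmax) fun t ht => by
    rw [abs_of_nonneg (hp.mem t ht.le).1]; exact (hp.mem t ht.le).2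

end IsPath

theorem Admissible.isBddMeas_cost {h : ℝ → ℝ} (ha : m.Admissible c h) (hc : IsCost c) :
    IsBddMeas fun t => c (h t) := by
  -- Nothing is known about c at negative arguments, so measurability goes through c (max x 0).
  have hcc : Continuous fun x => c (max x 0) :=
    hc.continuousOn.comp_continuous (by fun_prop) fun x => mem_Ici.2 (le_max_right _ _)
  refine ⟨?_, c (m.hMax c), fun t ht => ?_⟩
  · have h1 : Measurable fun t => c (max (h t) 0) := hcc.measurable.comp ha.1
    refine h1.aestronglyMeasurable.congr ?_
    refine (ae_restrict_iff' measurableSet_Ioi).2 (Eventually.of_forall fun t ht => ?_)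
    simp only [max_eq_left (ha.2 t (le_of_lt ht)).1]
  · have h1 := ha.2 t ht.le
    rw [abs_of_nonneg (hc.nonneg _ h1.1)]
    exact hc.strictMono.monotoneOn h1.1 (m.hMax_nonneg c) h1.2

namespace IsPath

variable {h k α β γ : ℝ → ℝ}

theorem isBddMeas_run (hp : m.IsPath c h γ) (hc : IsCost c) :
    IsBddMeas fun t => m.aBar * γ t + c (h t) :=
  (hp.isBddMeas_state.const_mul _).add (hp.adm.isBddMeas_cost hc)

theorem cost_eq (hp : m.IsPath c h γ) (hc : IsCost c) :
    m.cost c h γ = m.aBar * m.disc γ + m.disc fun t => c (h t) := by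
  rw [← disc_const_mul, ← disc_add (hp.isBddMeas_state.const_mul _) (hp.adm.isBddMeas_cost hc)]
  rfl

theorem run_nonneg (hp : m.IsPath c h γ) (hc : IsCost c) (t : ℝ) (ht : 0 ≤ t) :
    0 ≤ m.aBar * γ t + c (h t) :=
  add_nonneg (mul_nonneg m.aBar_pos.le (hp.mem t ht).1) (hc.nonneg _ (hp.adm.2 t ht).1)

end IsPath

/-! ### Value function: monotonicity, Lipschitz bound, concavity -/

theorem mem_costs_iff {γ₀ J : ℝ} (hγ₀ : γ₀ ∈ Icc 0 m.γmax) :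
    J ∈ m.costs c γ₀ ↔ ∃ h γ, m.IsPath c h γ ∧ γ 0 = γ₀ ∧ J = m.cost c h γ := by
  constructor
  · rintro ⟨h, γ, ha, hs, rfl⟩
    obtain ⟨h0, hp⟩ := hs.isPath ha hγ₀
    exact ⟨h, γ, hp, h0, rfl⟩
  · rintro ⟨h, γ, hp, rfl, rfl⟩
    exact ⟨h, γ, hp.adm, hp.isState, rfl⟩

theorem costs_nonempty {γ₀ : ℝ} (hγ₀ : γ₀ ∈ Icc 0 m.γmax) : (m.costs c γ₀).Nonempty := by
  have ha : m.Admissible c fun _ => 0 :=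
    ⟨measurable_const, fun _ _ => ⟨le_rfl, m.hMax_nonneg c⟩⟩
  obtain ⟨γ, h0, hp⟩ := exists_path ha hγ₀
  exact ⟨_, (mem_costs_iff hγ₀).2 ⟨_, γ, hp, h0, rfl⟩⟩

theorem zero_mem_lowerBounds_costs (hc : IsCost c) {γ₀ : ℝ} (hγ₀ : γ₀ ∈ Icc 0 m.γmax) :
    0 ∈ lowerBounds (m.costs c γ₀) := by
  intro J hJ
  obtain ⟨h, γ, hp, -, rfl⟩ := (mem_costs_iff hγ₀).1 hJ
  exact disc_nonneg fun t ht => hp.run_nonneg hc t ht.le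

theorem IsPath.v_le_cost {h γ : ℝ → ℝ} (hp : m.IsPath c h γ) (hc : IsCost c) :
    m.v c (γ 0) ≤ m.cost c h γ :=
  csInf_le ⟨0, zero_mem_lowerBounds_costs hc (hp.mem 0 le_rfl)⟩
    ((mem_costs_iff (hp.mem 0 le_rfl)).2 ⟨h, γ, hp, rfl, rfl⟩)

theorem le_v {γ₀ B : ℝ} (hγ₀ : γ₀ ∈ Icc 0 m.γmax)
    (hB : ∀ h γ, m.IsPath c h γ → γ 0 = γ₀ → B ≤ m.cost c h γ) : B ≤ m.v c γ₀ := by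
  refine le_csInf (costs_nonempty hγ₀) fun J hJ => ?_
  obtain ⟨h, γ, hp, h0, rfl⟩ := (mem_costs_iff hγ₀).1 hJ
  exact hB h γ hp h0

theorem v_nonneg (hc : IsCost c) {γ₀ : ℝ} (hγ₀ : γ₀ ∈ Icc 0 m.γmax) : 0 ≤ m.v c γ₀ :=
  le_csInf (costs_nonempty hγ₀) (zero_mem_lowerBounds_costs hc hγ₀)

/-- The dynamic programming inequality. -/
theorem IsPath.le_cost {h γ : ℝ → ℝ} (hp : m.IsPath c h γ) (hc : IsCost c) {t : ℝ} (ht : 0 ≤ t) :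
    Real.exp (-m.δ * t) * ((∫ s in (0 : ℝ)..t, (m.aBar * γ s + c (h s))) + m.v c (γ t))
      ≤ m.cost c h γ := by
  refine le_trans ?_ (le_disc (hp.isBddMeas_run hc) (fun s hs => hp.run_nonneg hc s hs.le) ht)
  have := (hp.shift ht).v_le_cost hc
  rw [zero_add] at this
  gcongr
  exact this

theorem v_mono (hc : IsCost c) : MonotoneOn (m.v c) (Icc 0 m.γmax) := by
  intro p hp q hq hpq
  refine le_v hq fun h β hβ hβ0 => ?_
  obtain ⟨α, hα0, hα⟩ := exists_path hβ.adm hp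
  rw [← hα0]
  refine (hα.v_le_cost hc).trans ?_
  rw [hα.cost_eq hc, hβ.cost_eq hc]
  gcongr
  · exact m.aBar_pos.le
  · exact disc_mono hα.isBddMeas_state hβ.isBddMeas_state fun t ht =>
      hα.le_of_le hβ (by linarith) t ht.le

/-- The same rate used from q keeps the two paths within q - p, and the discounted integral of this
constant is (q - p)/δ. This bound is the origin of `M₀`. -/
theorem v_sub_le (hc : IsCost c) {p q : ℝ} (hp : p ∈ Icc 0 m.γmax) (hq : q ∈ Icc 0 m.γmax)
    (hpq : p ≤ q) : m.v c q - m.v c p ≤ m.Lv * (q - p) := by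
  suffices m.v c q - m.Lv * (q - p) ≤ m.v c p by linarith
  refine le_v hp fun h α hα hα0 => ?_
  obtain ⟨β, hβ0, hβ⟩ := exists_path hα.adm hq
  have h1 := hβ.v_le_cost hc
  rw [hβ0, hβ.cost_eq hc] at h1
  rw [hα.cost_eq hc]
  have h2 : m.disc β ≤ m.disc α + (q - p) / m.δ := by
    rw [← disc_const, ← disc_add hα.isBddMeas_state (.const _)]
    refine disc_mono hβ.isBddMeas_state (hα.isBddMeas_state.add (.const _)) fun t ht => ?_
    have := hα.sub_le_sub hβ (by linarith) t ht.le
    rw [hα0, hβ0] at this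
    linarith
  have h3 := mul_le_mul_of_nonneg_left h2 m.aBar_pos.le
  have h4 : m.Lv * (q - p) = m.aBar * ((q - p) / m.δ) := by simp only [Lv]; ring
  rw [h4]
  linarith

/-- A fixed rate has the same information cost from every initial variance, and its path is concave
there; an infimum of concave functions is concave. -/
theorem v_concave (hc : IsCost c) : ConcaveOn ℝ (Icc 0 m.γmax) (m.v c) := by
  refine ⟨convex_Icc _ _, fun p hp q hq a b ha hb hab => ?_⟩
  refine le_v (convex_Icc 0 m.γmax hp hq ha hb hab) fun h γ hγ hγ0 => ?_
  obtain ⟨α, hα0, hα⟩ := exists_path hγ.adm hp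
  obtain ⟨β, hβ0, hβ⟩ := exists_path hγ.adm hq
  have h1 := hα.v_le_cost hc
  have h2 := hβ.v_le_cost hc
  rw [hα0, hα.cost_eq hc] at h1
  rw [hβ0, hβ.cost_eq hc] at h2
  rw [hγ.cost_eq hc]
  have h3 : a * m.disc α + b * m.disc β ≤ m.disc γ := by
    rw [← disc_const_mul, ← disc_const_mul, ← disc_add (hα.isBddMeas_state.const_mul _)
      (hβ.isBddMeas_state.const_mul _)]
    refine disc_mono ((hα.isBddMeas_state.const_mul _).add (hβ.isBddMeas_state.const_mul _))
      hγ.isBddMeas_state fun t ht => ?_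
    exact hα.concave hβ hγ ha hb hab (by rw [hα0, hβ0, hγ0]; rfl) t ht.le
  have h4 := mul_le_mul_of_nonneg_left h3 m.aBar_pos.le
  have h5 := mul_le_mul_of_nonneg_left h1 ha
  have h6 := mul_le_mul_of_nonneg_left h2 hb
  simp only [smul_eq_mul]
  obtain rfl : b = 1 - a := by linarith
  nlinarith

/-! ### Convexity in the conditional precision -/

/-- The weighted harmonic mean. -/
noncomputable def harm (a b x y : ℝ) : ℝ := 1 / (a * (1 / x) + b * (1 / y))

theorem harm_pos {a b x y : ℝ} (ha : 0 ≤ a) (hb : 0 ≤ b) (hab : a + b = 1) (hx : 0 < x)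
    (hy : 0 < y) : 0 < harm a b x y := by
  refine one_div_pos.2 ?_
  rcases ha.eq_or_lt with rfl | ha'
  · have : b = 1 := by linarith
    subst this; simpa using hy
  · positivity

theorem sub_harm_eq {a b x y : ℝ} (ha : 0 ≤ a) (hb : 0 ≤ b) (hab : a + b = 1) (hx : 0 < x)
    (hy : 0 < y) : a * x + b * y - harm a b x y = a * b * (x - y) ^ 2 / (a * y + b * x) := by
  have h1 : 0 < a * y + b * x := by
    rcases ha.eq_or_lt with rfl | ha'
    · have : b = 1 := by linarith
      subst this; simpa using hx
    · positivity
  have h2 : harm a b x y = x * y / (a * y + b * x) := by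
    rw [harm, show a * (1 / x) + b * (1 / y) = (a * y + b * x) / (x * y) by field_simp]
    rw [one_div_div]
  rw [h2, eq_div_iff h1.ne', sub_mul, div_mul_cancel₀ _ h1.ne']
  obtain rfl : b = 1 - a := by linarith
  ring

theorem harm_le {a b x y : ℝ} (ha : 0 ≤ a) (hb : 0 ≤ b) (hab : a + b = 1) (hx : 0 < x)
    (hy : 0 < y) : harm a b x y ≤ a * x + b * y := by
  have := sub_harm_eq ha hb hab hx hy
  have : 0 ≤ a * b * (x - y) ^ 2 / (a * y + b * x) := by positivity
  linarith

theorem harm_lt {a b x y : ℝ} (ha : 0 < a) (hb : 0 < b) (hab : a + b = 1) (hx : 0 < x)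
    (hy : 0 < y) (hxy : x ≠ y) : harm a b x y < a * x + b * y := by
  have := sub_harm_eq ha.le hb.le hab hx hy
  have h1 : 0 < (x - y) ^ 2 := by have := sub_ne_zero.2 hxy; positivity
  have : 0 < a * b * (x - y) ^ 2 / (a * y + b * x) := by positivity
  linarith

theorem harm_mem {a b x y : ℝ} (ha : 0 ≤ a) (hb : 0 ≤ b) (hab : a + b = 1)
    (hx : x ∈ Ioc 0 m.γmax) (hy : y ∈ Ioc 0 m.γmax) : harm a b x y ∈ Ioc 0 m.γmax := by
  refine ⟨harm_pos ha hb hab hx.1 hy.1, (harm_le ha hb hab hx.1 hy.1).trans ?_⟩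
  calc a * x + b * y ≤ a * m.γmax + b * m.γmax := by have := hx.2; have := hy.2; gcongr
    _ = m.γmax := by rw [← add_mul, hab, one_mul]

/-- Mixing two rates bounds the value at the harmonic mean of the initial variances. -/
theorem v_harm_le (hc : IsCost c) {h k α β : ℝ → ℝ} (hα : m.IsPath c h α) (hβ : m.IsPath c k β)
    (hα0 : 0 < α 0) (hβ0 : 0 < β 0) {a b : ℝ} (ha : 0 ≤ a) (hb : 0 ≤ b) (hab : a + b = 1) :
    IsBddMeas (fun t => harm a b (α t) (β t)) ∧
    m.v c (harm a b (α 0) (β 0)) ≤ m.aBar * m.disc (fun t => harm a b (α t) (β t)) +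
      (a * m.disc (fun t => c (h t)) + b * m.disc fun t => c (k t)) := by
  have hadm : m.Admissible c fun t => a * h t + b * k t :=
    ⟨(hα.adm.1.const_mul a).add (hβ.adm.1.const_mul b), fun t ht =>
      convex_Icc 0 (m.hMax c) (hα.adm.2 t ht) (hβ.adm.2 t ht) ha hb hab⟩
  have hαm : ∀ t, 0 ≤ t → α t ∈ Ioc 0 m.γmax := fun t ht => ⟨hα.pos hα0 t ht, (hα.mem t ht).2⟩
  have hβm : ∀ t, 0 ≤ t → β t ∈ Ioc 0 m.γmax := fun t ht => ⟨hβ.pos hβ0 t ht, (hβ.mem t ht).2⟩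
  have hm : ∀ t, 0 ≤ t → harm a b (α t) (β t) ∈ Ioc 0 m.γmax := fun t ht =>
    harm_mem ha hb hab (hαm t ht) (hβm t ht)
  have hH : IsBddMeas (fun t => harm a b (α t) (β t)) := by
    refine .of_continuousOn ?_ (B := m.γmax) fun t ht => by
      rw [abs_of_pos (hm t ht.le).1]; exact (hm t ht.le).2
    have h1 : ContinuousOn α (Ioi 0) := hα.prim.cont.mono Ioi_subset_Ici_self
    have h2 : ContinuousOn β (Ioi 0) := hβ.prim.cont.mono Ioi_subset_Ici_self
    refine continuousOn_const.div ((continuousOn_const.mul (continuousOn_const.div h1 ?_)).add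
      (continuousOn_const.mul (continuousOn_const.div h2 ?_))) ?_
    · exact fun t ht => (hαm t (le_of_lt ht)).1.ne'
    · exact fun t ht => (hβm t (le_of_lt ht)).1.ne'
    · exact fun t ht => (one_div_pos.1 (hm t (le_of_lt ht)).1).ne'
  refine ⟨hH, ?_⟩
  obtain ⟨γ, hγ0, hγ⟩ := exists_path hadm (Ioc_subset_Icc_self (hm 0 le_rfl))
  rw [← hγ0]
  refine (hγ.v_le_cost hc).trans ?_
  rw [hγ.cost_eq hc]
  -- The harmonic mean is kept under the integral: its gap to the arithmetic mean gives strictness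
  -- in `v_harm_lt`.
  have h1 : m.disc γ ≤ m.disc (fun t => harm a b (α t) (β t)) :=
    disc_mono hγ.isBddMeas_state hH fun t ht =>
      hα.le_harmonic hβ ha hb hab hγ hα0 hβ0 (by rw [hγ0, harm, one_div_one_div]) t ht.le
  have h2 : m.disc (fun t => c (a * h t + b * k t))
      ≤ a * m.disc (fun t => c (h t)) + b * m.disc fun t => c (k t) := by
    have i1 := (hα.adm.isBddMeas_cost hc).const_mul a
    have i2 := (hβ.adm.isBddMeas_cost hc).const_mul b
    rw [← disc_const_mul, ← disc_const_mul, ← disc_add i1 i2]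
    refine disc_mono (hadm.isBddMeas_cost hc) (i1.add i2) fun t ht => ?_
    exact hc.strictConvex.convexOn.2 (hα.adm.2 t ht.le).1 (hβ.adm.2 t ht.le).1 ha hb hab
  have h3 := mul_le_mul_of_nonneg_left h1 m.aBar_pos.le
  exact add_le_add h3 h2

theorem v_harm_le_add (hc : IsCost c) {p q : ℝ} (hp : p ∈ Ioc 0 m.γmax) (hq : q ∈ Ioc 0 m.γmax)
    {a b : ℝ} (ha : 0 ≤ a) (hb : 0 ≤ b) (hab : a + b = 1) :
    m.v c (harm a b p q) ≤ a * m.v c p + b * m.v c q := by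
  have key : ∀ h k α β : ℝ → ℝ, m.IsPath c h α → α 0 = p → m.IsPath c k β → β 0 = q →
      m.v c (harm a b p q) ≤ a * m.cost c h α + b * m.cost c k β := by
    intro h k α β hα hα0 hβ hβ0
    have h1 : 0 < α 0 := hα0 ▸ hp.1
    have h2 : 0 < β 0 := hβ0 ▸ hq.1
    obtain ⟨hH, hv⟩ := v_harm_le hc hα hβ h1 h2 ha hb hab
    rw [hα0, hβ0] at hv
    refine hv.trans ?_
    rw [hα.cost_eq hc, hβ.cost_eq hc]
    have h3 : m.disc (fun t => harm a b (α t) (β t)) ≤ a * m.disc α + b * m.disc β := by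
      have i1 := hα.isBddMeas_state.const_mul a
      have i2 := hβ.isBddMeas_state.const_mul b
      rw [← disc_const_mul, ← disc_const_mul, ← disc_add i1 i2]
      exact disc_mono hH (i1.add i2) fun t ht =>
        harm_le ha hb hab (hα.pos h1 t ht.le) (hβ.pos h2 t ht.le)
    have h4 := mul_le_mul_of_nonneg_left h3 m.aBar_pos.le
    linarith
  -- Taking the infimum over each rate in turn divides by a and by b, so zero weights are treated
  -- apart.
  rcases ha.eq_or_lt with rfl | ha'
  · obtain rfl : b = 1 := by linarith
    simp [harm]
  rcases hb.eq_or_lt with rfl | hb'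
  · obtain rfl : a = 1 := by linarith
    simp [harm]
  have h1 : ∀ k β, m.IsPath c k β → β 0 = q →
      m.v c (harm a b p q) ≤ a * m.v c p + b * m.cost c k β := by
    intro k β hβ hβ0
    have : (m.v c (harm a b p q) - b * m.cost c k β) / a ≤ m.v c p :=
      le_v (Ioc_subset_Icc_self hp) fun h α hα hα0 => by
        rw [div_le_iff₀ ha']; linarith [key h k α β hα hα0 hβ hβ0]
    rw [div_le_iff₀ ha'] at this
    linarith
  have : (m.v c (harm a b p q) - a * m.v c p) / b ≤ m.v c q :=
    le_v (Ioc_subset_Icc_self hq) fun k β hβ hβ0 => by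
      rw [div_le_iff₀ hb']; linarith [h1 k β hβ hβ0]
  rw [div_le_iff₀ hb'] at this
  linarith

theorem one_div_mem {y : ℝ} (hy : y ∈ Ici (1 / m.γmax)) : 0 < y ∧ 1 / y ∈ Ioc 0 m.γmax := by
  have hG := m.γmax_pos
  have hy0 : 0 < y := (one_div_pos.2 hG).trans_le hy
  exact ⟨hy0, one_div_pos.2 hy0, (one_div_le hy0 hG).2 hy⟩

/-- The value function is convex in the conditional precision. -/
theorem vCheck_convex (hc : IsCost c) :
    ConvexOn ℝ (Ici (1 / m.γmax)) fun z => m.v c (1 / z) := by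
  refine ⟨convex_Ici _, fun x hx y hy a b ha hb hab => ?_⟩
  have := v_harm_le_add hc (one_div_mem hx).2 (one_div_mem hy).2 ha hb hab
  simpa [harm] using this

/-! ### Differentiability of the value function -/

theorem hasDerivWithinAt_one_div_comp {f : ℝ → ℝ} {p d : ℝ} {s t : Set ℝ} (hp : 0 < p)
    (hf : HasDerivWithinAt f d s p) (hst : MapsTo (fun z : ℝ => 1 / z) t s) :
    HasDerivWithinAt (fun z => f (1 / z)) (-(p ^ 2 * d)) t (1 / p) := by
  have h1 : HasDerivWithinAt (fun z : ℝ => 1 / z) (-((1 / p) ^ 2)⁻¹) t (1 / p) := by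
    simpa using (hasDerivAt_inv (one_div_pos.2 hp).ne').hasDerivWithinAt
  have h2 := HasDerivWithinAt.comp (1 / p) (h₂ := f) (s' := s) (h₂' := d)
    (by rwa [one_div_one_div]) h1 hst
  convert! h2 using 1
  field_simp

/-- Concavity orders the one-sided derivatives one way. Convexity in 1/p orders them the other way,
as the reciprocal swaps the sides and also changes the sign. -/
theorem v_differentiableAt (hc : IsCost c) {p : ℝ} (hp : p ∈ Ioo 0 m.γmax) :
    DifferentiableAt ℝ (m.v c) p := by
  have hG := m.γmax_pos
  have hconv : ConvexOn ℝ (Icc 0 m.γmax) (-m.v c) := (v_concave hc).neg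
  have hpi : p ∈ interior (Icc 0 m.γmax) := by rwa [interior_Icc]
  have hR := hconv.hasDerivWithinAt_rightDeriv_of_mem_interior hpi
  have hL := hconv.hasDerivWithinAt_leftDeriv_of_mem_interior hpi
  have hLR := hconv.leftDeriv_le_rightDeriv_of_mem_interior hpi
  set R := derivWithin (-m.v c) (Ioi p) p
  set L := derivWithin (-m.v c) (Iio p) p
  have hR' : HasDerivWithinAt (m.v c) (-R) (Ioi p) p := by simpa using hR.neg
  have hL' : HasDerivWithinAt (m.v c) (-L) (Iio p) p := by simpa using hL.neg
  have hy : 0 < 1 / p := one_div_pos.2 hp.1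
  have hwR := hasDerivWithinAt_one_div_comp (t := Ioi (1 / p)) hp.1 hL'
    (fun z hz => (one_div_lt (hy.trans hz) hp.1).2 hz)
  have hwL := hasDerivWithinAt_one_div_comp (t := Ioo 0 (1 / p)) hp.1 hR'
    (fun z hz => (lt_one_div hp.1 hz.1).2 hz.2)
  have hwL' := hwL.mono_of_mem_nhdsWithin (Ioo_mem_nhdsLT hy)
  have hwi : 1 / p ∈ interior (Ici (1 / m.γmax)) := by
    rw [interior_Ici]; exact one_div_lt_one_div_of_lt hp.1 hp.2
  have hcomp := (vCheck_convex hc).leftDeriv_le_rightDeriv_of_mem_interior hwi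
  rw [hwR.derivWithin (uniqueDiffWithinAt_Ioi _), hwL'.derivWithin (uniqueDiffWithinAt_Iio _)]
    at hcomp
  have hsq : 0 < p ^ 2 := by have := hp.1; positivity
  have heq : L = R := le_antisymm hLR (by nlinarith)
  rw [heq] at hL'
  have h1 := hasDerivWithinAt_Ioi_iff_Ici.1 hR'
  have h2 := hasDerivWithinAt_Iio_iff_Iic.1 hL'
  have h3 := h2.union h1
  rw [Iic_union_Ici, hasDerivWithinAt_univ] at h3
  exact h3.differentiableAt

/-- At the end points the slopes are monotone by concavity and bounded, by `Lv` at 0 and by 0 at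
`γmax`, hence converge. -/
theorem v_differentiableOn (hc : IsCost c) : DifferentiableOn ℝ (m.v c) (Icc 0 m.γmax) := by
  have hG := m.γmax_pos
  intro p hp
  rcases hp.1.eq_or_lt with rfl | h0
  · have hanti : AntitoneOn (slope (m.v c) 0) (Ioo 0 m.γmax) :=
      ((v_concave hc).antitoneOn_slope_gt hp).mono fun x hx => ⟨Ioo_subset_Icc_self hx, hx.1⟩
    have hb : BddAbove (slope (m.v c) 0 '' Ioo 0 m.γmax) := by
      refine ⟨m.Lv, ?_⟩
      rintro _ ⟨x, hx, rfl⟩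
      rw [slope_def_field, div_le_iff₀ (by linarith [hx.1])]
      exact v_sub_le hc hp (Ioo_subset_Icc_self hx) hx.1.le
    have ht := hanti.tendsto_nhdsWithin_Ioo_right ⟨_, ⟨half_pos hG, half_lt_self hG⟩⟩ hb
    have hd : HasDerivWithinAt (m.v c) (sSup (slope (m.v c) 0 '' Ioo 0 m.γmax)) (Ioi 0) 0 := by
      rw [hasDerivWithinAt_iff_tendsto_slope]
      simpa using ht
    exact ((hasDerivWithinAt_Ioi_iff_Ici.1 hd).mono Icc_subset_Ici_self).differentiableWithinAt
  rcases hp.2.eq_or_lt with rfl | h1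
  · have hanti : AntitoneOn (slope (m.v c) m.γmax) (Ioo 0 m.γmax) :=
      ((v_concave hc).antitoneOn_slope_lt hp).mono fun x hx => ⟨Ioo_subset_Icc_self hx, hx.2⟩
    have hb : BddBelow (slope (m.v c) m.γmax '' Ioo 0 m.γmax) := by
      refine ⟨0, ?_⟩
      rintro _ ⟨x, hx, rfl⟩
      rw [slope_comm, slope_def_field]
      refine div_nonneg ?_ (by linarith [hx.2])
      linarith [v_mono hc (Ioo_subset_Icc_self hx) hp hx.2.le]
    have ht := hanti.tendsto_nhdsWithin_Ioo_left ⟨_, ⟨half_pos hG, half_lt_self hG⟩⟩ hb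
    have hd : HasDerivWithinAt (m.v c) (sInf (slope (m.v c) m.γmax '' Ioo 0 m.γmax))
        (Iio m.γmax) m.γmax := by
      rw [hasDerivWithinAt_iff_tendsto_slope]
      simpa using ht
    exact ((hasDerivWithinAt_Iio_iff_Iic.1 hd).mono Icc_subset_Iic_self).differentiableWithinAt
  · exact (v_differentiableAt hc ⟨h0, h1⟩).differentiableWithinAt

theorem v_hasDerivWithinAt (hc : IsCost c) {p : ℝ} (hp : p ∈ Icc 0 m.γmax) :
    HasDerivWithinAt (m.v c) (m.vDeriv c p) (Icc 0 m.γmax) p :=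
  (v_differentiableOn hc p hp).hasDerivWithinAt

theorem vDeriv_nonneg (hc : IsCost c) (p : ℝ) : 0 ≤ m.vDeriv c p :=
  (v_mono hc).derivWithin_nonneg

theorem vDeriv_le (hc : IsCost c) {p : ℝ} (hp : p ∈ Icc 0 m.γmax) : m.vDeriv c p ≤ m.Lv := by
  have h1 : MonotoneOn (fun x => m.Lv * x - m.v c x) (Icc 0 m.γmax) := fun x hx y hy hxy => by
    have := v_sub_le hc hx hy hxy
    dsimp only
    linarith
  have h2 : HasDerivWithinAt (fun x => m.Lv * x - m.v c x) (m.Lv * 1 - m.vDeriv c p)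
      (Icc 0 m.γmax) p := ((hasDerivWithinAt_id _ _).const_mul _).sub (v_hasDerivWithinAt hc hp)
  have h3 := h1.derivWithin_nonneg (x := p)
  rw [h2.derivWithin (uniqueDiffOn_Icc m.γmax_pos p hp)] at h3
  linarith

/-- A derivative has the intermediate value property (Darboux), and this one is monotone, so it
cannot jump. -/
theorem vDeriv_continuousOn (hc : IsCost c) : ContinuousOn (m.vDeriv c) (Icc 0 m.γmax) := by
  have hG := m.γmax_pos.le
  let f : ℝ → ℝ := fun x => -m.vDeriv c (projIcc 0 _ hG x)
  have hmono : Monotone f := fun x y hxy => neg_le_neg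
    ((v_concave hc).antitoneOn_derivWithin (v_differentiableOn hc) (projIcc 0 _ hG x).2
      (projIcc 0 _ hG y).2 (monotone_projIcc hG hxy))
  have hr : range f = (fun x => -m.vDeriv c x) '' Icc 0 m.γmax := by
    ext z
    constructor
    · rintro ⟨x, rfl⟩
      exact ⟨_, (projIcc 0 _ hG x).2, rfl⟩
    · rintro ⟨x, hx, rfl⟩
      exact ⟨x, by simp only [f, projIcc_of_mem hG hx]⟩
  have hcont : Continuous f := continuous_of_monotone_of_ordConnected_range hmono (by
    rw [hr]
    exact ordConnected_Icc.image_hasDerivWithinAt (f := fun x => -m.v c x)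
      fun x hx => (v_hasDerivWithinAt hc hx).neg)
  refine hcont.neg.continuousOn.congr fun x hx => ?_
  simp [f, projIcc_of_mem hG hx]

variable (m c) in
/-- The sensitivity `γ² v'(γ)` of the value with respect to the precision. -/
noncomputable def sens (γ : ℝ) : ℝ := γ ^ 2 * m.vDeriv c γ

theorem sens_zero : m.sens c 0 = 0 := by simp [sens]

theorem sens_continuousOn (hc : IsCost c) : ContinuousOn (m.sens c) (Icc 0 m.γmax) :=
  (continuousOn_id.pow 2).mul (vDeriv_continuousOn hc)

theorem sens_nonneg (hc : IsCost c) (p : ℝ) : 0 ≤ m.sens c p :=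
  mul_nonneg (sq_nonneg _) (vDeriv_nonneg hc p)

theorem sens_le (hc : IsCost c) {p : ℝ} (hp : p ∈ Icc 0 m.γmax) : m.sens c p ≤ m.M₀ := by
  have h1 := hp.1
  have h2 := hp.2
  exact mul_le_mul (by gcongr) (vDeriv_le hc hp) (vDeriv_nonneg hc p) (sq_nonneg _)

theorem vCheck_hasDerivWithinAt (hc : IsCost c) {y : ℝ} (hy : y ∈ Ici (1 / m.γmax)) :
    HasDerivWithinAt (fun z => m.v c (1 / z)) (-m.sens c (1 / y)) (Ici (1 / m.γmax)) y := by
  obtain ⟨hy0, hy1⟩ := one_div_mem hy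
  have := hasDerivWithinAt_one_div_comp hy1.1 (v_hasDerivWithinAt hc (Ioc_subset_Icc_self hy1))
    (t := Ici (1 / m.γmax)) fun z hz => Ioc_subset_Icc_self (one_div_mem hz).2
  rwa [one_div_one_div] at this

theorem vCheckDeriv_eq (hc : IsCost c) {y : ℝ} (hy : y ∈ Ici (1 / m.γmax)) :
    m.vCheckDeriv c y = -m.sens c (1 / y) :=
  (vCheck_hasDerivWithinAt hc hy).derivWithin (uniqueDiffOn_Ici _ y hy)

theorem one_div_mem_Ici {p : ℝ} (hp : p ∈ Ioc 0 m.γmax) : 1 / p ∈ Ici (1 / m.γmax) :=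
  one_div_le_one_div_of_le hp.1 hp.2

/-- Up to sign, `sens` is the derivative of a convex function of the precision, and the reciprocal
reverses the order. -/
theorem sens_monotoneOn (hc : IsCost c) : MonotoneOn (m.sens c) (Icc 0 m.γmax) := by
  intro p hp q hq hpq
  rcases hp.1.eq_or_lt with rfl | h0
  · rw [sens_zero]; exact sens_nonneg hc q
  · have hp' := one_div_mem_Ici (m := m) ⟨h0, hp.2⟩
    have hq' := one_div_mem_Ici (m := m) ⟨h0.trans_le hpq, hq.2⟩
    have h1 : m.vCheckDeriv c (1 / q) ≤ m.vCheckDeriv c (1 / p) :=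
      (vCheck_convex hc).monotoneOn_derivWithin
        (fun y hy => (vCheck_hasDerivWithinAt hc hy).differentiableWithinAt) hq' hp'
        (one_div_le_one_div_of_le h0 hpq)
    rw [vCheckDeriv_eq hc hp', vCheckDeriv_eq hc hq', one_div_one_div, one_div_one_div] at h1
    linarith

end Model

/-! ### Marginal cost and the maximizer ĥ -/

namespace IsCost

variable {c : ℝ → ℝ}

theorem hasDerivWithinAt (hc : IsCost c) {x : ℝ} (hx : 0 ≤ x) :
    HasDerivWithinAt c (marginalCost c x) (Ici 0) x :=
  ((hc.contDiff_one.differentiableOn (by decide)) x hx).hasDerivWithinAt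

theorem marginalCost_strictMonoOn (hc : IsCost c) : StrictMonoOn (marginalCost c) (Ici 0) :=
  hc.strictConvex.strictMonoOn_derivWithin (hc.contDiff_one.differentiableOn (by decide))

theorem marginalCost_continuousOn (hc : IsCost c) : ContinuousOn (marginalCost c) (Ici 0) :=
  hc.contDiff_one.continuousOn_derivWithin (uniqueDiffOn_Ici 0) le_rfl

theorem marginalCost_nonneg (hc : IsCost c) (x : ℝ) : 0 ≤ marginalCost c x :=
  hc.strictMono.monotoneOn.derivWithin_nonneg

theorem tangent_le (hc : IsCost c) {h k : ℝ} (hh : 0 ≤ h) (hk : 0 ≤ k) :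
    c k + marginalCost c k * (h - k) ≤ c h := by
  have hd := hc.hasDerivWithinAt hk
  rcases lt_trichotomy k h with hlt | rfl | hlt
  · have := hc.strictConvex.convexOn.le_slope_of_hasDerivWithinAt hk hh hlt hd
    rw [slope_def_field, le_div_iff₀ (by linarith)] at this
    linarith
  · simp
  · have := hc.strictConvex.convexOn.slope_le_of_hasDerivWithinAt hh hk hlt hd
    rw [slope_def_field, div_le_iff₀ (by linarith)] at this
    linarith

end IsCost

namespace Model

variable {m : Model} {c : ℝ → ℝ}

theorem hHat_spec (hc : IsCost c) (x : ℝ) : m.hHat c x ∈ Icc 0 (m.hMax c) ∧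
    IsMaxOn (fun h => h * x - c h) (Icc 0 (m.hMax c)) (m.hHat c x) :=
  Classical.epsilon_spec (m.existsUnique_maximizer hc x).exists

theorem hHat_eq (hc : IsCost c) {x k : ℝ} (hk : k ∈ Icc 0 (m.hMax c))
    (hmax : ∀ h ∈ Icc 0 (m.hMax c), h * x - c h ≤ k * x - c k) : m.hHat c x = k :=
  (m.existsUnique_maximizer hc x).unique (hHat_spec hc x) ⟨hk, fun h hh => hmax h hh⟩

/-- The tangent inequality at k says exactly that k maximizes h c'(k) - c(h): ĥ inverts c'. -/
theorem hHat_marginalCost (hc : IsCost c) {k : ℝ} (hk : k ∈ Icc 0 (m.hMax c)) :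
    m.hHat c (marginalCost c k) = k :=
  hHat_eq hc hk fun h hh => by linarith [hc.tangent_le hh.1 hk.1]

theorem hHat_eq_zero (hc : IsCost c) {x : ℝ} (hx : x ≤ marginalCost c 0) : m.hHat c x = 0 :=
  hHat_eq hc ⟨le_rfl, m.hMax_nonneg c⟩ fun h hh => by
    nlinarith [hc.tangent_le hh.1 le_rfl, mul_le_mul_of_nonneg_left hx hh.1]

theorem hHat_mono (hc : IsCost c) : Monotone (m.hHat c) := by
  intro x y hxy
  rcases hxy.eq_or_lt with rfl | hlt
  · exact le_rfl
  obtain ⟨h1, h2⟩ := hHat_spec (m := m) hc x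
  obtain ⟨h3, h4⟩ := hHat_spec (m := m) hc y
  have h5 : m.hHat c y * x - c (m.hHat c y) ≤ m.hHat c x * x - c (m.hHat c x) := h2 h3
  have h6 : m.hHat c x * y - c (m.hHat c x) ≤ m.hHat c y * y - c (m.hHat c y) := h4 h1
  by_contra! hn
  nlinarith [mul_pos (sub_pos.2 hlt) (sub_pos.2 hn)]

theorem hHat_continuous (hc : IsCost c) : Continuous (m.hHat c) := by
  refine continuous_of_monotone_of_ordConnected_range (hHat_mono hc) ?_
  have : range (m.hHat c) = Icc 0 (m.hMax c) := by
    ext k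
    constructor
    · rintro ⟨x, rfl⟩
      exact (hHat_spec hc x).1
    · exact fun hk => ⟨_, hHat_marginalCost hc hk⟩
  rw [this]
  exact ordConnected_Icc

/-- The cap on the rate corresponds exactly to the bound of `sens`, so it does not flatten ĥ on the
relevant range. -/
theorem marginalCost_hMax (hc : IsCost c) (hex : ∃ h : ℝ, 0 ≤ h ∧ m.M₀ ≤ marginalCost c h)
    (h0 : marginalCost c 0 ≤ m.M₀) : marginalCost c (m.hMax c) = m.M₀ := by
  obtain ⟨h, hh, hle⟩ := hex
  obtain ⟨k, hk, hkeq⟩ := intermediate_value_Icc hh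
    (hc.marginalCost_continuousOn.mono Icc_subset_Ici_self) ⟨h0, hle⟩
  rw [m.hMax_eq hc.marginalCost_strictMonoOn hk.1 hkeq, hkeq]

theorem hHat_strictMonoOn (hc : IsCost c) (hex : ∃ h : ℝ, 0 ≤ h ∧ m.M₀ ≤ marginalCost c h) :
    StrictMonoOn (m.hHat c) (Icc (marginalCost c 0) m.M₀) := by
  intro x hx y hy hxy
  have hM := marginalCost_hMax hc hex (hx.1.trans hx.2)
  have hsurj : ∀ z ∈ Icc (marginalCost c 0) m.M₀,
      ∃ k ∈ Icc 0 (m.hMax c), marginalCost c k = z := fun z hz =>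
    intermediate_value_Icc (m.hMax_nonneg c)
      (hc.marginalCost_continuousOn.mono Icc_subset_Ici_self) (by rwa [hM])
  obtain ⟨k, hk, rfl⟩ := hsurj x hx
  obtain ⟨l, hl, rfl⟩ := hsurj y hy
  rw [hHat_marginalCost hc hk, hHat_marginalCost hc hl]
  exact (hc.marginalCost_strictMonoOn.lt_iff_lt hk.1 hl.1).1 hxy

/-! ### Feedback, Hamilton–Jacobi–Bellman inequality, optimality -/

theorem feedback_mem (hc : IsCost c) (γ : ℝ) : m.feedback c γ ∈ Icc 0 (m.hMax c) :=
  (hHat_spec hc _).1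

theorem feedback_continuousOn (hc : IsCost c) : ContinuousOn (m.feedback c) (Icc 0 m.γmax) :=
  (hHat_continuous hc).comp_continuousOn (sens_continuousOn hc)

theorem feedback_monotoneOn (hc : IsCost c) : MonotoneOn (m.feedback c) (Icc 0 m.γmax) :=
  fun _ hp _ hq hpq => hHat_mono hc (sens_monotoneOn hc hp hq hpq)

/-- The feedback map minimizes the Hamiltonian. -/
theorem hamiltonian_feedback_le (hc : IsCost c) {γ k : ℝ} (hk : k ∈ Icc 0 (m.hMax c)) :
    c (m.feedback c γ) + m.vDeriv c γ * m.f γ (m.feedback c γ)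
      ≤ c k + m.vDeriv c γ * m.f γ k := by
  have h : k * (γ ^ 2 * m.vDeriv c γ) - c k
      ≤ m.feedback c γ * (γ ^ 2 * m.vDeriv c γ) - c (m.feedback c γ) := (hHat_spec hc _).2 hk
  simp only [f]
  linarith

/-- The value function is a supersolution of the Hamilton–Jacobi–Bellman equation. -/
theorem hjb_le (hc : IsCost c) {γ₀ : ℝ} (hγ₀ : γ₀ ∈ Icc 0 m.γmax) :
    m.aBar * γ₀ + (c (m.feedback c γ₀) + m.vDeriv c γ₀ * m.f γ₀ (m.feedback c γ₀))
      ≤ m.δ * m.v c γ₀ := by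
  by_contra! hlt
  set D := m.vDeriv c γ₀
  have hD : 0 ≤ D := vDeriv_nonneg hc γ₀
  set V := m.v c γ₀
  have hV0 : 0 ≤ V := v_nonneg hc hγ₀
  set Q := m.aBar * γ₀ + (c (m.feedback c γ₀) + D * m.f γ₀ (m.feedback c γ₀)) with hQ
  set K := m.speed c
  have hK : 0 ≤ K := (abs_nonneg _).trans (abs_f_le hγ₀ (feedback_mem hc γ₀))
  have hL := stateLip_nonneg (m := m) (c := c)
  set L := m.stateLip c
  have hA := m.aBar_pos
  have hδ := m.δ_pos
  set E := Q - m.δ * V with hE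
  have hE0 : 0 < E := sub_pos.2 hlt
  -- If the inequality failed by E > 0, a short time t would raise the value by at least t (E - C t
  -- - η K). Here η controls the first-order expansion of `v`, and η and t are chosen so that each
  -- error costs at most E/4.
  set η := E / (4 * (K + 1)) with hη
  have hη0 : 0 < η := by positivity
  have hηK : η * K ≤ E / 4 := by
    rw [hη, div_mul_eq_mul_div, div_le_div_iff₀ (by positivity) (by norm_num)]
    nlinarith
  obtain ⟨r, hr, hder⟩ := Metric.mem_nhdsWithin_iff.1
    ((hasDerivWithinAt_iff_isLittleO.1 (v_hasDerivWithinAt hc hγ₀)).def hη0)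
  -- The coefficient of t²: the variation of the Hamiltonian along a path of speed at most K, and
  -- the remainder of e^{δt}.
  set C := (m.aBar + D * L) * K + V * m.δ ^ 2 with hC
  have hC0 : 0 ≤ C := by positivity
  obtain ⟨t, ht0, ht1, ht2, ht3⟩ : ∃ t : ℝ, 0 < t ∧ K * t < r ∧ m.δ * t ≤ 1 ∧ C * t ≤ E / 4 := by
    refine ⟨min (r / (2 * (K + 1))) (min (1 / m.δ) (E / (4 * (C + 1)))), by positivity, ?_, ?_, ?_⟩
    · calc _ ≤ K * (r / (2 * (K + 1))) := by gcongr; exact min_le_left _ _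
        _ < r := by
          rw [mul_div_assoc', div_lt_iff₀ (by positivity)]
          nlinarith
    · calc _ ≤ m.δ * (1 / m.δ) := by
            gcongr; exact (min_le_right _ _).trans (min_le_left _ _)
        _ ≤ 1 := by rw [mul_one_div_cancel hδ.ne']
    · calc _ ≤ C * (E / (4 * (C + 1))) := by
            gcongr; exact (min_le_right _ _).trans (min_le_right _ _)
        _ ≤ E / 4 := by
          rw [mul_div_assoc', div_le_div_iff₀ (by positivity) (by norm_num)]
          nlinarith
  -- The bound is uniform over all rates, so it passes to the infimum.
  have hmain : Real.exp (-m.δ * t) * (V + t * (Q - (m.aBar + D * L) * K * t - η * K)) ≤ V := by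
    refine le_v hγ₀ fun h γ hγ h0 => le_trans ?_ (hγ.le_cost hc ht0.le)
    refine mul_le_mul_of_nonneg_left ?_ (Real.exp_pos _).le
    have hdist : ∀ s ∈ Icc 0 t, |γ s - γ₀| ≤ K * t := fun s hs => by
      have := hγ.prim.abs_sub_le hγ.abs_speed_le le_rfl hs.1
      rw [h0, sub_zero, abs_of_nonneg hs.1] at this
      exact this.trans (by have := hs.2; gcongr)
    have hvt : V + D * (γ t - γ₀) - η * (K * t) ≤ m.v c (γ t) := by
      have h1 := hdist t ⟨ht0.le, le_rfl⟩
      have h2 : γ t ∈ Metric.ball γ₀ r ∩ Icc 0 m.γmax :=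
        ⟨by rw [Metric.mem_ball, Real.dist_eq]; linarith, hγ.mem t ht0.le⟩
      have h3 : ‖m.v c (γ t) - V - (γ t - γ₀) • D‖ ≤ η * ‖γ t - γ₀‖ := hder h2
      rw [Real.norm_eq_abs, Real.norm_eq_abs, smul_eq_mul] at h3
      have h4 := (abs_le.1 h3).1
      have h5 := mul_le_mul_of_nonneg_left h1 hη0.le
      linarith
    have hrun := (hγ.isBddMeas_run hc).intervalIntegrable ht0.le
    have hprim := hγ.prim.integrable t ht0.le
    have hint : t * (Q - (m.aBar + D * L) * K * t)
        ≤ (∫ s in (0 : ℝ)..t, (m.aBar * γ s + c (h s))) + D * (γ t - γ₀) := by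
      have h1 : γ t - γ₀ = ∫ s in (0 : ℝ)..t, m.f (γ s) (h s) := by
        rw [← h0]; exact hγ.prim.sub_eq le_rfl ht0.le
      rw [h1, ← intervalIntegral.integral_const_mul,
        ← intervalIntegral.integral_add hrun (hprim.const_mul D)]
      have h2 : t * (Q - (m.aBar + D * L) * K * t)
          = ∫ _ in (0 : ℝ)..t, (Q - (m.aBar + D * L) * K * t) := by
        rw [intervalIntegral.integral_const, sub_zero, smul_eq_mul]
      rw [h2]
      refine intervalIntegral.integral_mono_on_of_le_Ioo ht0.le (by simp)
        (hrun.add (hprim.const_mul D)) fun s hs => ?_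
      have hs' : s ∈ Icc 0 t := Ioo_subset_Icc_self hs
      have h3 := hdist s hs'
      have h4 := hγ.adm.2 s hs'.1
      have h5 := hamiltonian_feedback_le (m := m) hc (γ := γ₀) h4
      have h6 := abs_f_sub_le (hγ.mem s hs'.1) hγ₀ h4
      have h7 := (abs_le.1 (h6.trans (mul_le_mul_of_nonneg_left h3 hL))).1
      have h8 := mul_le_mul_of_nonneg_left h7 hD
      have h9 := mul_le_mul_of_nonneg_left (abs_le.1 h3).1 hA.le
      simp only [hQ]
      linarith
    linarith
  have hexp : Real.exp (m.δ * t) ≤ 1 + m.δ * t + (m.δ * t) ^ 2 := by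
    have h1 : |m.δ * t| ≤ 1 := by rw [abs_of_nonneg (by positivity)]; exact ht2
    have := (abs_le.1 (Real.abs_exp_sub_one_sub_id_le h1)).2
    linarith
  rw [neg_mul, Real.exp_neg, inv_mul_le_iff₀ (Real.exp_pos _)] at hmain
  have h1 := mul_le_mul_of_nonneg_right hexp hV0
  have h2 : t * (E - C * t - η * K) ≤ 0 := by
    simp only [hE, hC]
    linarith
  have h3 : 0 < t * (E - C * t - η * K) := mul_pos ht0 (by linarith)
  linarith

/-- The feedback map generates an optimal rate. -/
theorem exists_optimal (hc : IsCost c) {γ₀ : ℝ} (hγ₀ : γ₀ ∈ Icc 0 m.γmax) :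
    ∃ h γ : ℝ → ℝ, Continuous h ∧ m.IsPath c h γ ∧ γ 0 = γ₀ ∧
      (∀ t, 0 ≤ t → h t = m.feedback c (γ t)) ∧ m.cost c h γ = m.v c γ₀ := by
  have hG := m.γmax_pos.le
  have hfc : ContinuousOn (fun γ => m.f γ (m.feedback c γ)) (Icc 0 m.γmax) := by
    have := feedback_continuousOn (m := m) hc
    simp only [f]
    fun_prop
  -- The closed-loop drift is decreasing because `f` decreases in both arguments and the feedback
  -- increases.
  obtain ⟨x, hx0, hxm, hx⟩ := exists_solution_of_antitoneOn hG hfc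
    (fun p hp q hq hpq => by
      have h1 := feedback_monotoneOn hc hp hq hpq
      have h2 := f_anti (m := m) hp.1 hpq (feedback_mem (m := m) hc p).1
      refine le_trans ?_ h2
      simp only [f]
      nlinarith [mul_le_mul_of_nonneg_right h1 (sq_nonneg q)])
    (by simp only [f]; nlinarith [sq_nonneg m.σ₂])
    (by
      refine le_trans ?_ m.f_γmax_neg.le
      have := mul_nonneg (feedback_mem (m := m) hc m.γmax).1 (sq_nonneg m.γmax)
      simp only [f]
      linarith) hγ₀
  -- Freezing the path at negative times makes the rate continuous on ℝ, hence Borel.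
  let X : ℝ → ℝ := fun t => x (max t 0)
  have hXm : ∀ t, X t ∈ Icc 0 m.γmax := fun t => hxm _ (le_max_right _ _)
  have hXc : Continuous X :=
    hx.cont.comp_continuous (by fun_prop) fun t => mem_Ici.2 (le_max_right t 0)
  have hXx : ∀ t, 0 ≤ t → X t = x t := fun t ht => by simp only [X, max_eq_left ht]
  let h : ℝ → ℝ := fun t => m.feedback c (X t)
  have hhc : Continuous h := (feedback_continuousOn hc).comp_continuous hXc hXm
  let φ : ℝ → ℝ := fun t => m.f (X t) (h t)
  have hφ : Continuous φ := by simp only [φ, f]; fun_prop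
  have hXφ : ∀ t, 0 ≤ t → X t = X 0 + ∫ s in (0 : ℝ)..t, φ s := by
    intro t ht
    rw [hXx t ht, hXx 0 le_rfl, hx.eq t ht]
    congr 1
    refine intervalIntegral.integral_congr fun s hs => ?_
    rw [uIcc_of_le ht] at hs
    simp only [φ, h, hXx s hs.1]
  have hpath : m.IsPath c h X :=
    ⟨⟨hhc.measurable, fun t _ => feedback_mem hc _⟩,
      ⟨hXc.continuousOn, fun t _ => hφ.intervalIntegrable 0 t, hXφ⟩, fun t _ => hXm t⟩
  have hX0 : X 0 = γ₀ := by rw [hXx 0 le_rfl, hx0]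
  refine ⟨h, X, hhc, hpath, hX0, fun _ _ => rfl, le_antisymm ?_ (hX0 ▸ hpath.v_le_cost hc)⟩
  let ψ : ℝ → ℝ := fun s => Real.exp (-m.δ * s) * (m.aBar * X s + c (h s))
  have hψ : Continuous ψ := by
    have : Continuous fun s => c (h s) :=
      hc.continuousOn.comp_continuous hhc fun s => (feedback_mem (m := m) hc _).1
    exact (by fun_prop : Continuous fun s => Real.exp (-m.δ * s)).mul
      ((continuous_const.mul hXc).add this)
  -- Verification function: `hjb_le` makes its derivative nonpositive. Dropping the nonnegative
  -- value term and letting t → ∞ bounds the cost by W 0.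
  let W : ℝ → ℝ := fun t => Real.exp (-m.δ * t) * m.v c (X t) + ∫ s in (0 : ℝ)..t, ψ s
  have hvX : Continuous fun t => m.v c (X t) :=
    (v_differentiableOn hc).continuousOn.comp_continuous hXc hXm
  have hWc : Continuous W := (by fun_prop : Continuous fun t =>
    Real.exp (-m.δ * t) * m.v c (X t)).add
      (intervalIntegral.continuous_primitive (fun a b => hψ.intervalIntegrable a b) 0)
  have hWd : ∀ t, 0 < t → HasDerivAt W (Real.exp (-m.δ * t) * (m.aBar * X t +
      (c (h t) + m.vDeriv c (X t) * m.f (X t) (h t)) - m.δ * m.v c (X t))) t := by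
    intro t ht
    have d1 : HasDerivAt X (φ t) t := by
      refine ((intervalIntegral.integral_hasDerivAt_right (hφ.intervalIntegrable 0 t)
        (hφ.stronglyMeasurableAtFilter _ _) hφ.continuousAt).const_add
          (X 0)).congr_of_eventuallyEq ?_
      filter_upwards [lt_mem_nhds ht] with u hu
      exact hXφ u hu.le
    have d2 : HasDerivAt (fun t => m.v c (X t)) (m.vDeriv c (X t) * φ t) t :=
      (v_hasDerivWithinAt hc (hXm t)).comp_hasDerivAt t d1 (Eventually.of_forall hXm)
    have d3 : HasDerivAt (fun t => Real.exp (-m.δ * t)) (Real.exp (-m.δ * t) * -m.δ) t := by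
      simpa using ((hasDerivAt_id t).const_mul (-m.δ)).exp
    have d4 := intervalIntegral.integral_hasDerivAt_right (hψ.intervalIntegrable 0 t)
      (hψ.stronglyMeasurableAtFilter _ _) hψ.continuousAt
    convert! (d3.mul d2).add d4 using 1
    simp only [φ, ψ]
    ring
  have hanti : AntitoneOn W (Ici 0) := by
    refine antitoneOn_of_deriv_nonpos (convex_Ici 0) hWc.continuousOn ?_ ?_
    · intro t ht
      rw [interior_Ici] at ht
      exact (hWd t ht).differentiableAt.differentiableWithinAt
    · intro t ht
      rw [interior_Ici] at ht
      rw [(hWd t ht).deriv]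
      have := hjb_le hc (hXm t)
      exact mul_nonpos_of_nonneg_of_nonpos (Real.exp_pos _).le (by simp only [h]; linarith)
  have hlim := intervalIntegral_tendsto_integral_Ioi 0
    (integrableOn_disc (m := m) (hpath.isBddMeas_run hc)) tendsto_id
  refine le_of_tendsto hlim ?_
  filter_upwards [eventually_ge_atTop 0] with t ht
  have h1 := hanti (mem_Ici.2 le_rfl) (mem_Ici.2 ht) ht
  have h2 : W 0 = m.v c γ₀ := by simp [W, hX0]
  have h3 : 0 ≤ Real.exp (-m.δ * t) * m.v c (X t) :=
    mul_nonneg (Real.exp_pos _).le (v_nonneg hc (hXm t))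
  rw [h2] at h1
  simp only [W] at h1
  simp only [id]
  change ∫ s in (0 : ℝ)..t, ψ s ≤ _
  linarith

/-! ### Strict convexity and the threshold -/

/-- Since the infima are attained, optimal paths can be mixed. They differ on some interval (0, τ)
by continuity, and there the harmonic mean is strictly below the arithmetic mean. -/
theorem v_harm_lt (hc : IsCost c) {p q : ℝ} (hp : p ∈ Ioc 0 m.γmax) (hq : q ∈ Ioc 0 m.γmax)
    (hpq : p ≠ q) {a b : ℝ} (ha : 0 < a) (hb : 0 < b) (hab : a + b = 1) :
    m.v c (harm a b p q) < a * m.v c p + b * m.v c q := by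
  obtain ⟨h, α, -, hα, hα0, -, hαv⟩ := exists_optimal hc (Ioc_subset_Icc_self hp)
  obtain ⟨k, β, -, hβ, hβ0, -, hβv⟩ := exists_optimal hc (Ioc_subset_Icc_self hq)
  have h1 : 0 < α 0 := hα0 ▸ hp.1
  have h2 : 0 < β 0 := hβ0 ▸ hq.1
  obtain ⟨hH, hv⟩ := v_harm_le hc hα hβ h1 h2 ha.le hb.le hab
  rw [hα0, hβ0] at hv
  refine hv.trans_lt ?_
  rw [← hαv, ← hβv, hα.cost_eq hc, hβ.cost_eq hc]
  have hcα : Tendsto α (𝓝[>] 0) (𝓝 (α 0)) :=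
    (hα.prim.cont 0 (mem_Ici.2 le_rfl)).mono Ioi_subset_Ici_self
  have hcβ : Tendsto β (𝓝[>] 0) (𝓝 (β 0)) :=
    (hβ.prim.cont 0 (mem_Ici.2 le_rfl)).mono Ioi_subset_Ici_self
  have hne : ∀ᶠ t in 𝓝[>] (0 : ℝ), α t ≠ β t :=
    ((hcα.sub hcβ).eventually_ne (sub_ne_zero.2 (by rwa [hα0, hβ0]))).mono
      fun _ => sub_ne_zero.1
  obtain ⟨τ, hτ, hτne⟩ := mem_nhdsGT_iff_exists_Ioo_subset.1 hne
  have h3 : m.disc (fun t => harm a b (α t) (β t)) < a * m.disc α + b * m.disc β := by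
    have i1 := hα.isBddMeas_state.const_mul a
    have i2 := hβ.isBddMeas_state.const_mul b
    rw [← disc_const_mul, ← disc_const_mul, ← disc_add i1 i2]
    exact disc_lt hH (i1.add i2)
      (fun t ht => harm_le ha.le hb.le hab (hα.pos h1 t ht.le) (hβ.pos h2 t ht.le)) hτ
      fun t ht ht' => harm_lt ha hb hab (hα.pos h1 t ht.le) (hβ.pos h2 t ht.le) (hτne ⟨ht, ht'⟩)
  have h4 := mul_lt_mul_of_pos_left h3 m.aBar_pos
  linarith

theorem vCheck_strictConvex (hc : IsCost c) :
    StrictConvexOn ℝ (Ici (1 / m.γmax)) fun z => m.v c (1 / z) := by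
  refine ⟨convex_Ici _, fun x hx y hy hxy a b ha hb hab => ?_⟩
  have := v_harm_lt hc (one_div_mem hx).2 (one_div_mem hy).2
    (fun h => hxy (by simpa using h)) ha hb hab
  simpa [harm] using this

theorem sens_strictMonoOn (hc : IsCost c) : StrictMonoOn (m.sens c) (Icc 0 m.γmax) := by
  have key : ∀ p q, 0 < p → p < q → q ≤ m.γmax → m.sens c p < m.sens c q := by
    intro p q h0 hpq hq
    have hp' := one_div_mem_Ici (m := m) ⟨h0, hpq.le.trans hq⟩
    have hq' := one_div_mem_Ici (m := m) ⟨h0.trans hpq, hq⟩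
    have h1 : m.vCheckDeriv c (1 / q) < m.vCheckDeriv c (1 / p) :=
      (vCheck_strictConvex hc).strictMonoOn_derivWithin
        (fun y hy => (vCheck_hasDerivWithinAt hc hy).differentiableWithinAt) hq' hp'
        (one_div_lt_one_div_of_lt h0 hpq)
    rw [vCheckDeriv_eq hc hp', vCheckDeriv_eq hc hq', one_div_one_div, one_div_one_div] at h1
    linarith
  intro p hp q hq hpq
  rcases hp.1.eq_or_lt with rfl | h0
  · rw [sens_zero]
    -- Variance 0 has infinite precision, so strictness is obtained between q/2 and q.
    exact (sens_nonneg hc (q / 2)).trans_lt (key _ _ (half_pos hpq) (half_lt_self hpq) hq.2)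
  · exact key p q h0 hpq hq.2

theorem vCheckDeriv_tendsto (hc : IsCost c) : Tendsto (m.vCheckDeriv c) atTop (𝓝 0) := by
  have hG := m.γmax_pos
  have h1 : Tendsto (fun y : ℝ => 1 / y) atTop (𝓝[Icc 0 m.γmax] 0) := by
    refine tendsto_nhdsWithin_iff.2 ⟨by simpa using tendsto_inv_atTop_zero (𝕜 := ℝ), ?_⟩
    filter_upwards [eventually_ge_atTop (1 / m.γmax)] with y hy
    exact Ioc_subset_Icc_self (one_div_mem hy).2
  have h2 : Tendsto (fun y => -m.sens c (1 / y)) atTop (𝓝 (-m.sens c 0)) :=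
    (((sens_continuousOn hc) 0 ⟨le_rfl, hG.le⟩).tendsto.comp h1).neg
  rw [sens_zero, neg_zero] at h2
  refine h2.congr' ?_
  filter_upwards [eventually_ge_atTop (1 / m.γmax)] with y hy
  exact (vCheckDeriv_eq hc hy).symm

theorem vCheckDerivExt_top (hc : IsCost c) : m.vCheckDerivExt c ∞ = 0 := by
  simp only [vCheckDerivExt, if_true]
  exact (vCheckDeriv_tendsto hc).limUnder_eq

theorem toReal_mem_Ici {y : ℝ≥0∞} (hy : ENNReal.ofReal (1 / m.γmax) ≤ y) (ht : y ≠ ∞) :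
    y.toReal ∈ Ici (1 / m.γmax) :=
  (ENNReal.ofReal_le_iff_le_toReal ht).1 hy

theorem one_div_toReal_mem {y : ℝ≥0∞} (hy : ENNReal.ofReal (1 / m.γmax) ≤ y) :
    (1 / y).toReal ∈ Icc 0 m.γmax := by
  rcases eq_or_ne y ∞ with rfl | ht
  · simpa using m.γmax_pos.le
  · have := (one_div_mem (toReal_mem_Ici hy ht)).2
    simpa [ENNReal.toReal_inv] using Ioc_subset_Icc_self this

/-- The formula includes y = ∞, since both the limiting slope and `sens` at 0 vanish. -/
theorem vCheckDerivExt_eq (hc : IsCost c) {y : ℝ≥0∞} (hy : ENNReal.ofReal (1 / m.γmax) ≤ y) :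
    m.vCheckDerivExt c y = -m.sens c (1 / y).toReal := by
  rcases eq_or_ne y ∞ with rfl | ht
  · rw [vCheckDerivExt_top hc]; simp [sens_zero]
  · rw [vCheckDerivExt, if_neg ht, vCheckDeriv_eq hc (toReal_mem_Ici hy ht)]
    simp [ENNReal.toReal_inv]

theorem vCheckDerivExt_injOn (hc : IsCost c) :
    InjOn (m.vCheckDerivExt c) (Ici (ENNReal.ofReal (1 / m.γmax))) := by
  intro y hy z hz hyz
  rw [vCheckDerivExt_eq hc hy, vCheckDerivExt_eq hc hz, neg_inj] at hyz
  have h1 := (sens_strictMonoOn hc).injOn (one_div_toReal_mem hy) (one_div_toReal_mem hz) hyz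
  have h0 : ∀ w : ℝ≥0∞, ENNReal.ofReal (1 / m.γmax) ≤ w → 1 / w ≠ ∞ := by
    intro w hw
    have : 0 < w := (ENNReal.ofReal_pos.2 (one_div_pos.2 m.γmax_pos)).trans_le hw
    simp [this.ne']
  have h2 := (ENNReal.toReal_eq_toReal_iff' (h0 y hy) (h0 z hz)).1 h1
  simpa using h2

/-- The threshold at an extended precision where the derivative of the value is `-c'(0)`. -/
theorem γD_eq (hc : IsCost c) {y : ℝ≥0∞} (hy : ENNReal.ofReal (1 / m.γmax) ≤ y)
    (heq : m.vCheckDerivExt c y = -marginalCost c 0) : m.γD c = (1 / y).toReal := by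
  have ex : ∃ y : ℝ≥0∞, ENNReal.ofReal (1 / m.γmax) ≤ y ∧
      m.vCheckDerivExt c y = -marginalCost c 0 := ⟨y, hy, heq⟩
  rw [γD, dif_pos ex]
  rw [vCheckDerivExt_injOn hc ex.choose_spec.1 hy (ex.choose_spec.2.trans heq.symm)]

/-- By the intermediate value theorem `sens`, which starts at 0, either attains c'(0) or stays below
it throughout. -/
theorem γD_spec (hc : IsCost c) : m.γD c ∈ Icc 0 m.γmax ∧
    (m.sens c (m.γD c) = marginalCost c 0 ∨
      m.γD c = m.γmax ∧ m.sens c m.γmax < marginalCost c 0) := by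
  have hG := m.γmax_pos
  by_cases ex : ∃ y : ℝ≥0∞, ENNReal.ofReal (1 / m.γmax) ≤ y ∧
      m.vCheckDerivExt c y = -marginalCost c 0
  · obtain ⟨y, hy, heq⟩ := ex
    rw [γD_eq hc hy heq]
    refine ⟨one_div_toReal_mem hy, Or.inl ?_⟩
    rw [vCheckDerivExt_eq hc hy] at heq
    exact neg_injective heq
  · have hγ : m.γD c = m.γmax := by rw [γD, dif_neg ex]
    rw [hγ]
    refine ⟨⟨hG.le, le_rfl⟩, Or.inr ⟨rfl, ?_⟩⟩
    by_contra! hle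
    obtain ⟨p, hp, hpeq⟩ := intermediate_value_Icc hG.le (sens_continuousOn hc)
      (⟨by rw [sens_zero]; exact hc.marginalCost_nonneg 0, hle⟩ :
        marginalCost c 0 ∈ Icc (m.sens c 0) (m.sens c m.γmax))
    -- For p = 0 this witness is ∞.
    have hy : ENNReal.ofReal (1 / m.γmax) ≤ 1 / ENNReal.ofReal p := by
      rw [one_div, one_div, ENNReal.ofReal_inv_of_pos hG]
      exact ENNReal.inv_le_inv.2 (ENNReal.ofReal_le_ofReal hp.2)
    refine ex ⟨_, hy, ?_⟩
    rw [vCheckDerivExt_eq hc hy]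
    simp [ENNReal.toReal_ofReal hp.1, hpeq]

theorem feedback_eq_zero (hc : IsCost c) {γ : ℝ} (hγ : γ ∈ Icc 0 (m.γD c)) :
    m.feedback c γ = 0 := by
  obtain ⟨hD, h⟩ := γD_spec (m := m) hc
  have h1 := sens_monotoneOn hc ⟨hγ.1, hγ.2.trans hD.2⟩ hD hγ.2
  refine hHat_eq_zero hc (h1.trans ?_)
  rcases h with h | ⟨h, hlt⟩
  · exact h.le
  · rw [h]; exact hlt.le

theorem feedback_strictMonoOn (hc : IsCost c)
    (hex : ∃ h : ℝ, 0 ≤ h ∧ m.M₀ ≤ marginalCost c h) :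
    StrictMonoOn (m.feedback c) (Icc (m.γD c) m.γmax) := by
  obtain ⟨hD, h⟩ := γD_spec (m := m) hc
  rcases h with h | ⟨h, -⟩
  · have hsub : Icc (m.γD c) m.γmax ⊆ Icc 0 m.γmax := Icc_subset_Icc_left hD.1
    refine (hHat_strictMonoOn hc hex).comp ((sens_strictMonoOn hc).mono hsub) fun γ hγ => ⟨?_, ?_⟩
    · rw [← h]; exact sens_monotoneOn hc hD (hsub hγ) hγ.1
    · exact sens_le hc (hsub hγ)
  -- Here the interval is a single point.
  · intro p hp q hq hpq
    rw [h] at hp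
    exact absurd hpq (not_lt.2 (hq.2.trans hp.1))

end Model

/-! ### Power costs -/

section PowerCost

variable {ζ ε : ℝ}

theorem powerCost_isCost (hζ : 0 < ζ) (hε : 0 < ε) : IsCost (powerCost ζ ε) where
  nonneg x hx := mul_nonneg hζ.le (Real.rpow_nonneg hx _)
  strictConvex := by
    have h := strictConvexOn_rpow (by linarith : 1 < 1 + ε)
    refine ⟨convex_Ici 0, fun x hx y hy hxy a b ha hb hab => ?_⟩
    have := mul_lt_mul_of_pos_left (h.2 hx hy hxy ha hb hab) hζ
    simp only [powerCost, smul_eq_mul] at this ⊢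
    linarith
  strictMono x hx y _ hxy :=
    mul_lt_mul_of_pos_left (Real.rpow_lt_rpow hx hxy (by linarith)) hζ
  contDiff_one := (contDiff_const.mul
    (Real.contDiff_rpow_const_of_le (n := 1) (by push_cast; linarith))).contDiffOn
  contDiff_two := contDiffOn_const.mul
    (contDiffOn_id.rpow_const_of_ne fun x hx => (ne_of_gt hx))

theorem marginalCost_powerCost (hε : 0 < ε) {x : ℝ} (hx : 0 ≤ x) :
    marginalCost (powerCost ζ ε) x = ζ * ((1 + ε) * x ^ ε) := by
  have h := (Real.hasDerivAt_rpow_const (x := x) (Or.inr (by linarith : 1 ≤ 1 + ε))).const_mul ζ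
  rw [add_sub_cancel_left] at h
  exact h.hasDerivWithinAt.derivWithin (uniqueDiffOn_Ici 0 x hx)

theorem exists_le_marginalCost_powerCost (hζ : 0 < ζ) (hε : 0 < ε) (M : ℝ) :
    ∃ h : ℝ, 0 ≤ h ∧ M ≤ marginalCost (powerCost ζ ε) h := by
  have h1 : Tendsto (fun x : ℝ => ζ * ((1 + ε) * x ^ ε)) atTop atTop :=
    ((tendsto_rpow_atTop hε).const_mul_atTop (by linarith : 0 < 1 + ε)).const_mul_atTop hζ
  obtain ⟨x, hx, hM⟩ := ((eventually_ge_atTop 0).and (h1.eventually_ge_atTop M)).exists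
  exact ⟨x, hx, by rwa [marginalCost_powerCost hε hx]⟩

theorem γD_powerCost (m : Model) (hζ : 0 < ζ) (hε : 0 < ε) : m.γD (powerCost ζ ε) = 0 := by
  have hc := powerCost_isCost hζ hε
  rw [Model.γD_eq hc (y := ∞) le_top]
  · simp
  · rw [Model.vCheckDerivExt_top hc, marginalCost_powerCost hε le_rfl, Real.zero_rpow hε.ne']
    simp

end PowerCost

end InfoAcquisition

theorem mainTheorem5 (m : Model) :
    (∀ c : ℝ → ℝ, IsCost c → (∃ h : ℝ, 0 ≤ h ∧ m.M₀ ≤ marginalCost c h) →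
      -- the derivatives of the value function and the threshold are well defined
      DifferentiableOn ℝ (m.v c) (Icc 0 m.γmax) ∧
      Tendsto (m.vCheckDeriv c) atTop (𝓝 (m.vCheckDerivExt c ∞)) ∧
      InjOn (m.vCheckDerivExt c) (Ici (ENNReal.ofReal (1 / m.γmax))) ∧
      m.γD c ∈ Icc 0 m.γmax ∧
      -- the feedback map vanishes below the threshold and strictly increases above it
      (∀ γ ∈ Icc 0 (m.γD c), m.feedback c γ = 0) ∧
      StrictMonoOn (m.feedback c) (Icc (m.γD c) m.γmax) ∧
      -- acting according to the feedback map is optimal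
      (∀ γ₀ ∈ Icc 0 m.γmax, ∃ h γ : ℝ → ℝ,
        m.Admissible c h ∧ ContinuousOn h (Ici 0) ∧ m.IsState h γ₀ γ ∧
        (∀ t, 0 ≤ t → γ t ∈ Icc 0 m.γmax ∧ h t = m.feedback c (γ t)) ∧
        IsLeast (m.costs c γ₀) (m.cost c h γ))) ∧
    (∀ ζ ε : ℝ, 0 < ζ → 0 < ε →
      IsCost (powerCost ζ ε) ∧ (∃ h : ℝ, 0 ≤ h ∧ m.M₀ ≤ marginalCost (powerCost ζ ε) h) ∧
      m.γD (powerCost ζ ε) = 0) := by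
  refine ⟨fun c hc hex => ⟨Model.v_differentiableOn hc, ?_, Model.vCheckDerivExt_injOn hc,
    (Model.γD_spec hc).1, fun γ hγ => Model.feedback_eq_zero hc hγ,
    Model.feedback_strictMonoOn hc hex, fun γ₀ hγ₀ => ?_⟩, fun ζ ε hζ hε =>
      ⟨powerCost_isCost hζ hε, exists_le_marginalCost_powerCost hζ hε _, γD_powerCost m hζ hε⟩⟩
  · rw [Model.vCheckDerivExt_top hc]
    exact Model.vCheckDeriv_tendsto hc
  · obtain ⟨h, γ, hh, hp, h0, hfb, hcost⟩ := Model.exists_optimal hc hγ₀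
    refine ⟨h, γ, hp.adm, hh.continuousOn, h0 ▸ hp.isState,
      fun t ht => ⟨hp.mem t ht, hfb t ht⟩, ?_⟩
    refine ⟨(Model.mem_costs_iff hγ₀).2 ⟨h, γ, hp, h0, rfl⟩, fun J hJ => ?_⟩
    rw [hcost]
    exact csInf_le ⟨0, Model.zero_mem_lowerBounds_costs hc hγ₀⟩ hJ
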